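/- **Setting.** Let $M$ be a 6-manifold. An $SU(2)$ structure $(J,g,\alpha,\omega,\Omega)$ on $M$ consists of an almost Hermitian structure $(J,g)$, a $(1,0)$-form $\alpha$ with $\|\alpha\|^2=2$, a real 2-form $\omega$ and a $(2,0)$-form $\Omega$ with $\omega^2=\frac12\,\Omega\wedge\overline\Omega$ nowhere zero, $\omega\wedge\Omega=0$, $\Omega\wedge\Omega=0$, such that the contractions of $\omega$ and $\Omega$ with the vectors dual to $\mathrm{Re}(\alpha)$ and $\mathrm{Im}(\alpha)$ vanish, and such that the fundamental form $g(J\cdot,\cdot)$ equals $F=\omega+\frac i2\,\alpha\wedge\overline\alpha$; $M$ is oriented by $F^3$, and $*$ is the Hodge star of $g$. Let $k_\parallel\in(0,1)$ and $k_\perp=\sqrt{1-k_\parallel^2}$, and put, for an angle $\varphi$, $$\mathrm{Re}(\Omega)_\parallel=\tfrac12\big((1-\cos2\varphi)\,\mathrm{Re}(\Omega)+\sin2\varphi\;\omega\big),\qquad \mathrm{Re}(\Omega)_\perp=\tfrac12\big((1+\cos2\varphi)\,\mathrm{Re}(\Omega)-\sin2\varphi\;\omega\big),$$ where $\varphi\in(-\frac\pi2,0)$,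 $k_\parallel=-\sin\varphi$, $k_\perp=\cos\varphi$ in type IIA, and $\varphi\in(0,\frac\pi2)$, $k_\parallel=\cos\varphi$, $k_\perp=\sin\varphi$ in type IIB. Let $g_s>0$ and $\theta\in\mathbb R$ be constants. *SUSY equations IIA* (with fluxes $H\in\Omega^3$, $F_k\in\Omega^k$, $k=0,2,4$): $d(\mathrm{Re}\,\alpha)=0$; $k_\parallel H=k_\perp\, d(\mathrm{Im}\,\Omega)$; $d(\mathrm{Re}(\Omega)_\perp)=k_\parallel k_\perp\,\mathrm{Re}(\alpha)\wedge d(\mathrm{Im}\,\alpha)$; $H\wedge\mathrm{Re}(\alpha)=-\frac{k_\perp}{k_\parallel}\,d(\mathrm{Im}(\alpha)\wedge\mathrm{Re}(\Omega)_\parallel)$; together with $$g_s{*}F_0=\tfrac12k_\perp\, d(\mathrm{Im}\,\alpha)\wedge(\mathrm{Im}\,\Omega)^2+\tfrac1{k_\parallel}H\wedge\mathrm{Re}(\alpha)\wedge\mathrm{Re}(\Omega)_\parallel,$$ $$g_s{*}F_2=-k_\parallel\, d(\mathrm{Im}\,\alpha)\wedge\mathrm{Im}(\Omega)+\tfrac1{k_\parallel}d(\mathrm{Re}(\Omega)_\parallel)\wedge\mathrm{Re}(\alpha),\qquad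 g_s{*}F_4=-k_\perp\, d(\mathrm{Im}\,\alpha).$$ *SUSY equations IIB* (with fluxes $H\in\Omega^3$, $F_1\in\Omega^1$, $F_3\in\Omega^3$): $d(\mathrm{Re}\,\alpha)=0$; $d(\mathrm{Im}\,\alpha)=0$; $k_\parallel H=k_\perp\, d(\mathrm{Im}\,\Omega)$; $\mathrm{Re}(\alpha)\wedge H=-\frac{k_\perp}{k_\parallel}\mathrm{Im}(\alpha)\wedge d(\mathrm{Re}(\Omega)_\perp)$; $\mathrm{Im}(\alpha)\wedge H=\frac{k_\perp}{k_\parallel}\mathrm{Re}(\alpha)\wedge d(\mathrm{Re}(\Omega)_\perp)$; $\mathrm{Re}(\alpha)\wedge\mathrm{Im}(\alpha)\wedge d(\mathrm{Re}(\Omega)_\parallel)=-H\wedge\mathrm{Im}(\Omega)$; together with $k_\perp e^{i\theta}g_s{*}F_1=H\wedge\mathrm{Re}(\Omega)_\parallel$ and $k_\perp e^{i\theta}g_s{*}F_3=d(\mathrm{Re}(\Omega)_\parallel)$. **Proposition.** Let $(N^4,g,I,J,K)$ be a compact hyperkähler 4-manifold: $I,J,K$ are $g$-orthogonal complex structures with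 $IJ=K=-JI$ that are parallel for the Levi-Civita connection; let $\omega_A=g(A\,\cdot,\cdot)$ for $A=I,J,K$ be the Kähler forms. Let $\beta^1,\beta^2$ be closed smooth 1-forms on the torus $\mathbb T^2=S^1\times S^1$ which are linearly independent at every point. Then for every $k_\parallel\in(0,1)$ the following hold on $M=N\times\mathbb T^2$ (pullbacks to $M$ are not written). 1. There is an $SU(2)$ structure on $M$ with $$\mathrm{Re}(\alpha)=\beta^1,\quad \mathrm{Im}(\alpha)=\tfrac1{k_\parallel}\beta^2,\quad \mathrm{Re}(\Omega)_\parallel=-k_\parallel\,\omega_J,\quad \mathrm{Re}(\Omega)_\perp=k_\perp\,\omega_K,\quad \mathrm{Im}(\Omega)=\omega_I$$ (type IIA conventions) that solves the SUSY equations IIA for every $g_s>0$, with all the fluxes equal to zero; no other $(H,F_0,F_2,F_4)$ satisfies the equations for it. 2. There is an $SU(2)$ structure on $M$ with $$\mathrm{Re}(\alpha)=\tfrac1{k_\parallel}\beta^1,\quad \mathrm{Im}(\alpha)=\beta^2,\quad \mathrm{Re}(\Omega)_\parallel=k_\perp\,\omega_K,\quad \mathrm{Re}(\Omega)_\perp=k_\parallel\,\omega_I,\quad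 \mathrm{Im}(\Omega)=\omega_J$$ (type IIB conventions) that solves the SUSY equations IIB for every $g_s>0$ and $\theta\in\mathbb R$, with all the fluxes equal to zero; no other $(H,F_1,F_3)$ satisfies the equations for it. -/

import Mathlib

open scoped Manifold ContDiff
open Bundle

noncomputable section

namespace FluxVacua

/-! ### Differential forms on manifolds -/

section Forms

variable {V : Type*} [AddCommGroup V] [Module ℝ V] [TopologicalSpace V]
  {A : Type*} [NormedCommRing A] [NormedAlgebra ℝ A] {k l : ℕ}

/-- The multilinear map `(v₁, …, v_{k+l}) ↦ f (v₁, …, v_k) * g (v_{k+1}, …, v_{k+l})`. -/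
def mulForms (f : V [⋀^Fin k]→L[ℝ] A) (g : V [⋀^Fin l]→L[ℝ] A) :
    ContinuousMultilinearMap ℝ (fun _ : Fin (k + l) => V) A where
  toMultilinearMap :=
    ((LinearMap.mul' ℝ A).compMultilinearMap
      (f.toMultilinearMap.domCoprod g.toMultilinearMap)).domDomCongr finSumFinEquiv
  cont := by
    change Continuous fun v : Fin (k + l) → V =>
      f (fun i => v (finSumFinEquiv (Sum.inl i))) * g (fun j => v (finSumFinEquiv (Sum.inr j)))
    exact (f.cont.comp (by fun_prop)).mul (g.cont.comp (by fun_prop))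

/-- The wedge product of alternating forms, normalized by
`(f ∧ g)(v) = 1/(k! l!) ∑_σ sgn σ f(v_{σ 1}, …, v_{σ k}) g(v_{σ (k+1)}, …, v_{σ (k+l)})`,
so that `(f ∧ g)(u, v) = f u * g v - f v * g u` for `1`-forms. -/
def wedgeAlt [IsTopologicalAddGroup V] [ContinuousConstSMul ℝ V]
    (f : V [⋀^Fin k]→L[ℝ] A) (g : V [⋀^Fin l]→L[ℝ] A) : V [⋀^Fin (k + l)]→L[ℝ] A :=
  ((k.factorial * l.factorial : ℝ)⁻¹) •
    ContinuousMultilinearMap.alternatization (mulForms f g)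

theorem wedgeAlt_apply [IsTopologicalAddGroup V] [ContinuousConstSMul ℝ V]
    (f : V [⋀^Fin k]→L[ℝ] A) (g : V [⋀^Fin l]→L[ℝ] A) (v : Fin (k + l) → V) :
    wedgeAlt f g v = ((k.factorial * l.factorial : ℝ)⁻¹) •
      ∑ σ : Equiv.Perm (Fin (k + l)), Equiv.Perm.sign σ •
        (f (fun i => v (σ (Fin.castAdd l i))) * g (fun j => v (σ (Fin.natAdd k j)))) := by
  rw [wedgeAlt, ContinuousAlternatingMap.smul_apply,
    ContinuousMultilinearMap.alternatization_apply_apply]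
  rfl

end Forms

section ManifoldForms

variable {E : Type*} [NormedAddCommGroup E] [NormedSpace ℝ E]
  {H : Type*} [TopologicalSpace H] (I : ModelWithCorners ℝ E H)
  (M : Type*) [TopologicalSpace M] [ChartedSpace H M]
  (A : Type*) [NormedCommRing A] [NormedAlgebra ℝ A]

/-- A (not necessarily smooth) `A`-valued differential `k`-form on `M`. -/
abbrev DForm (k : ℕ) : Type _ := (x : M) → (TangentSpace I x [⋀^Fin k]→L[ℝ] A)

variable {I M A} {k l : ℕ}

/-- The wedge product of differential forms. -/
def DForm.wedge (α : DForm I M A k) (β : DForm I M A l) : DForm I M A (k + l) :=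
  fun x => wedgeAlt (α x) (β x)

infixl:75 " ∧ᵈ " => DForm.wedge

/-- The expression of a form in the preferred chart around `x₀`: the pullback of the form under
the inverse of the chart. -/
def DForm.chartRep (α : DForm I M A k) (x₀ : M) (y : E) : E [⋀^Fin k]→L[ℝ] A :=
  (α ((extChartAt I x₀).symm y)).compContinuousLinearMap
    (mfderivWithin 𝓘(ℝ, E) I (extChartAt I x₀).symm (Set.range I) y :)

/-- A form is smooth if its chart expressions are. -/
def DForm.IsSmooth (α : DForm I M A k) : Prop :=
  ∀ x₀ : M, ContDiffOn ℝ ∞ (α.chartRep x₀) (extChartAt I x₀).target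

/-- The exterior derivative: at `x`, the exterior derivative of the expression of the form in the
chart around `x`, pulled back by that chart. -/
def DForm.d (α : DForm I M A k) : DForm I M A (k + 1) := fun x =>
  (extDerivWithin (α.chartRep x) (Set.range I) (extChartAt I x x)).compContinuousLinearMap
    (mfderiv I 𝓘(ℝ, E) (extChartAt I x) x :)

/-- A closed form. -/
def DForm.IsClosedForm (α : DForm I M A k) : Prop := α.d = 0

variable {E' : Type*} [NormedAddCommGroup E'] [NormedSpace ℝ E']
  {H' : Type*} [TopologicalSpace H'] {I' : ModelWithCorners ℝ E' H'}
  {M' : Type*} [TopologicalSpace M'] [ChartedSpace H' M']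

/-- The pullback of a form under a map. -/
def DForm.pullback (f : M → M') (α : DForm I' M' A k) : DForm I M A k := fun x =>
  (α (f x)).compContinuousLinearMap (mfderiv I I' f x)

/-- Real part of a complex form. -/
def DForm.re (α : DForm I M ℂ k) : DForm I M ℝ k := fun x =>
  Complex.reCLM.compContinuousAlternatingMap (α x)

/-- Imaginary part of a complex form. -/
def DForm.im (α : DForm I M ℂ k) : DForm I M ℝ k := fun x =>
  Complex.imCLM.compContinuousAlternatingMap (α x)

/-- Complex conjugate of a complex form. -/
def DForm.conj (α : DForm I M ℂ k) : DForm I M ℂ k := fun x =>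
  (Complex.conjCLE : ℂ →L[ℝ] ℂ).compContinuousAlternatingMap (α x)

/-- A real form regarded as a complex form. -/
def DForm.toComplex (α : DForm I M ℝ k) : DForm I M ℂ k := fun x =>
  Complex.ofRealCLM.compContinuousAlternatingMap (α x)

end ManifoldForms

/-! ### Hyperkähler manifolds -/

section Hyperkahler

variable {E : Type*} [NormedAddCommGroup E] [NormedSpace ℝ E]
  {H : Type*} [TopologicalSpace H] (I : ModelWithCorners ℝ E H)
  (N : Type*) [TopologicalSpace N] [ChartedSpace H N] [IsManifold I ∞ N]
  [RiemannianBundle (fun x : N => TangentSpace I x)]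

/-- A smooth almost complex structure on `N` which is orthogonal for the Riemannian metric. -/
structure OrthogonalComplexStructure where
  /-- The endomorphism of the tangent bundle. -/
  toFun : (x : N) → (TangentSpace I x →L[ℝ] TangentSpace I x)
  smooth : ContMDiff I (I.prod 𝓘(ℝ, E →L[ℝ] E)) ∞
    (fun x => TotalSpace.mk' (E →L[ℝ] E)
      (E := fun x : N => TangentSpace I x →L[ℝ] TangentSpace I x) x (toFun x))
  sq : ∀ x v, toFun x (toFun x v) = -v
  orthogonal : ∀ x u v, inner ℝ (toFun x u) (toFun x v) = inner ℝ u v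

variable {I N}

theorem OrthogonalComplexStructure.inner_self (J : OrthogonalComplexStructure I N) (x : N)
    (v : TangentSpace I x) : inner ℝ (J.toFun x v) v = 0 := by
  have h := J.orthogonal x (J.toFun x v) v
  rw [J.sq, inner_neg_left, real_inner_comm] at h
  linarith

/-- The fundamental (Kähler) `2`-form `ω_J(u, v) = g(J u, v)`. -/
def OrthogonalComplexStructure.kahlerForm (J : OrthogonalComplexStructure I N) :
    DForm I N ℝ 2 := fun x =>
  { toFun := fun v => inner ℝ (J.toFun x (v 0)) (v 1)
    map_update_add' := by
      intro _ m i a b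
      fin_cases i <;> simp [inner_add_left, inner_add_right]
    map_update_smul' := by
      intro _ m i c a
      fin_cases i <;> simp [inner_smul_left, inner_smul_right]
    map_eq_zero_of_eq' := by
      intro v i j hv hij
      have h01 : v 0 = v 1 := by
        fin_cases i <;> fin_cases j <;> simp_all
      change inner ℝ (J.toFun x (v 0)) (v 1) = 0
      rw [h01]
      exact J.inner_self x (v 1)
    cont := by
      change Continuous fun v : Fin 2 → TangentSpace I x => inner ℝ (J.toFun x (v 0)) (v 1)
      fun_prop }

/-- An endomorphism field of the tangent bundle is parallel for the connection `∇`: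
`∇ (J Y) = J (∇ Y)` for all differentiable vector fields `Y`. -/
def IsParallelEndo [FiniteDimensional ℝ E]
    (nabla : CovariantDerivative I E (fun x : N => TangentSpace I x))
    (J : (x : N) → (TangentSpace I x →L[ℝ] TangentSpace I x)) : Prop :=
  ∀ (x : N) (Y : (y : N) → TangentSpace I y),
    MDifferentiableAt I (I.prod 𝓘(ℝ, E)) (fun y => TotalSpace.mk' E y (Y y)) x →
      nabla (fun y => J y (Y y)) x = (J x).comp (nabla Y x)

variable (I N) in
/-- A hyperkähler structure on the Riemannian manifold `N`: three orthogonal complex structures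
with the quaternion relations which are parallel for the Levi-Civita connection, that is, for the
torsion-free connection compatible with the metric. -/
structure HyperkahlerStructure [FiniteDimensional ℝ E]
    [IsContMDiffRiemannianBundle I ∞ E (fun x : N => TangentSpace I x)] where
  I₁ : OrthogonalComplexStructure I N
  J₁ : OrthogonalComplexStructure I N
  K₁ : OrthogonalComplexStructure I N
  IJ : ∀ x v, I₁.toFun x (J₁.toFun x v) = K₁.toFun x v
  JI : ∀ x v, J₁.toFun x (I₁.toFun x v) = -K₁.toFun x v
  parallel : ∃ nabla : CovariantDerivative I E (fun x : N => TangentSpace I x),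
    nabla.torsion = 0 ∧ nabla.IsMetricCompatible ∧
      IsParallelEndo nabla I₁.toFun ∧ IsParallelEndo nabla J₁.toFun ∧
      IsParallelEndo nabla K₁.toFun

end Hyperkahler

/-! ### `SU(2)` structures on 6-manifolds -/

section SU2

variable {E : Type*} [NormedAddCommGroup E] [NormedSpace ℝ E]
  {H : Type*} [TopologicalSpace H] (I : ModelWithCorners ℝ E H)
  (M : Type*) [TopologicalSpace M] [ChartedSpace H M] [IsManifold I ∞ M]

/-- An `SU(2)` structure `(J, g, α, ω, Ω)` on a `6`-manifold: an almost Hermitian structure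
`(J, g)`, a `(1,0)`-form `α` of norm `√2`, a real `2`-form `ω` and a `(2,0)`-form `Ω`. -/
structure SU2Structure where
  dim_eq : Module.finrank ℝ E = 6
  /-- The Riemannian metric. -/
  g : ContMDiffRiemannianMetric I ∞ E (fun x : M => TangentSpace I x)
  /-- The almost complex structure. -/
  J : (x : M) → (TangentSpace I x →L[ℝ] TangentSpace I x)
  /-- The `(1,0)`-form. -/
  alpha : DForm I M ℂ 1
  /-- The real `2`-form. -/
  omega : DForm I M ℝ 2
  /-- The `(2,0)`-form. -/
  Omega : DForm I M ℂ 2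
  smooth_J : ContMDiff I (I.prod 𝓘(ℝ, E →L[ℝ] E)) ∞
    (fun x => TotalSpace.mk' (E →L[ℝ] E)
      (E := fun x : M => TangentSpace I x →L[ℝ] TangentSpace I x) x (J x))
  smooth_alpha : alpha.IsSmooth
  smooth_omega : omega.IsSmooth
  smooth_Omega : Omega.IsSmooth
  J_sq : ∀ x v, J x (J x v) = -v
  J_orthogonal : ∀ x u v, g.inner x (J x u) (J x v) = g.inner x u v
  /-- `α` is of type `(1,0)`. -/
  alpha_type : ∀ x v, alpha x ![J x v] = Complex.I * alpha x ![v]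
  /-- `Ω` is of type `(2,0)`. -/
  Omega_type : ∀ x u v, Omega x ![J x u, v] = Complex.I * Omega x ![u, v]
  /-- `ω² = ½ Ω ∧ Ω̄`. -/
  omega_sq : (omega ∧ᵈ omega).toComplex = (1 / 2 : ℂ) • (Omega ∧ᵈ Omega.conj)
  omega_sq_ne : ∀ x, (omega ∧ᵈ omega) x ≠ 0
  omega_wedge_Omega : omega.toComplex ∧ᵈ Omega = 0
  Omega_wedge_Omega : Omega ∧ᵈ Omega = 0
  /-- The contractions of `ω` and `Ω` with the vectors dual to `Re α` and `Im α` vanish. -/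
  contraction : ∀ (x : M) (a : TangentSpace I x),
    ((∀ v, g.inner x a v = alpha.re x ![v]) ∨ (∀ v, g.inner x a v = alpha.im x ![v])) →
      ∀ v, omega x ![a, v] = 0 ∧ Omega x ![a, v] = 0
  /-- `‖α‖² = i_ᾱ α = 2`; here `a - i b` is the complex vector dual to `ᾱ`. -/
  norm_alpha : ∀ (x : M) (a b : TangentSpace I x),
    (∀ v, g.inner x a v = alpha.re x ![v]) → (∀ v, g.inner x b v = alpha.im x ![v]) →
      alpha x ![a] - Complex.I * alpha x ![b] = 2
  /-- The fundamental form of `(J, g)` is `ω + (i/2) α ∧ ᾱ`. -/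
  fundamental : ∀ x u v, ((g.inner x (J x u) v : ℝ) : ℂ) =
    (omega.toComplex + (Complex.I / 2) • (alpha ∧ᵈ alpha.conj)) x ![u, v]

variable {I M}

namespace SU2Structure

variable (S : SU2Structure I M)

/-- The fundamental form `F = ω + (i/2) α ∧ ᾱ`, a real form. -/
def fundamentalForm : DForm I M ℝ 2 :=
  (S.omega.toComplex + (Complex.I / 2) • (S.alpha ∧ᵈ S.alpha.conj)).re

/-- The Riemannian volume form `F³ / 6` for the orientation given by `J`. -/
def vol : DForm I M ℝ 6 :=
  (1 / 6 : ℝ) • (S.fundamentalForm ∧ᵈ S.fundamentalForm ∧ᵈ S.fundamentalForm)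

/-- `γ = * β`: for every `k`-form `η` one has `η ∧ γ = ⟨η, β⟩ vol`, where
`⟨η, β⟩ = 1/k! ∑ η(e_{i₁}, …, e_{i_k}) β(e_{i₁}, …, e_{i_k})` for an orthonormal basis `e`. -/
def IsHodgeStar {k l : ℕ} (hkl : k + l = 6) (β : DForm I M ℝ k) (γ : DForm I M ℝ l) : Prop :=
  ∀ (x : M) (e : Module.Basis (Fin 6) ℝ (TangentSpace I x)),
    (∀ i j, S.g.inner x (e i) (e j) = if i = j then 1 else 0) →
    ∀ (η : TangentSpace I x [⋀^Fin k]→L[ℝ] ℝ) (v : Fin 6 → TangentSpace I x),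
      wedgeAlt η (γ x) (v ∘ Fin.cast hkl) =
        ((k.factorial : ℝ)⁻¹ * ∑ i : Fin k → Fin 6, η (e ∘ i) * β x (e ∘ i)) * S.vol x v

/-- `Re(Ω)_∥ = ½ ((1 - cos 2φ) Re Ω + sin 2φ ω)`, part of the projection basis with angle `φ`. -/
def reOmegaPar (φ : ℝ) : DForm I M ℝ 2 :=
  (1 / 2 : ℝ) • ((1 - Real.cos (2 * φ)) • S.Omega.re + Real.sin (2 * φ) • S.omega)

/-- `Re(Ω)_⊥ = ½ ((1 + cos 2φ) Re Ω - sin 2φ ω)`, part of the projection basis with angle `φ`. -/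
def reOmegaPerp (φ : ℝ) : DForm I M ℝ 2 :=
  (1 / 2 : ℝ) • ((1 + Real.cos (2 * φ)) • S.Omega.re - Real.sin (2 * φ) • S.omega)

end SU2Structure

/-- `k_⊥` as a function of `k_∥`. -/
def kPerp (kpar : ℝ) : ℝ := √(1 - kpar ^ 2)

/-- The angle `φ ∈ [-π/2, 0]` with `k_∥ = - sin φ` and `k_⊥ = cos φ` (IIA, `O6`-planes). -/
def angleIIA (kpar : ℝ) : ℝ := -Real.arcsin kpar

/-- The angle `φ ∈ [0, π/2]` with `k_∥ = cos φ` and `k_⊥ = sin φ` (IIB, `O5`-planes). -/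
def angleIIB (kpar : ℝ) : ℝ := Real.arccos kpar

/-- The intermediate `SU(2)` structure `S` with parameter `k_∥` solves the SUSY equations IIA
with fluxes `H`, `F₀`, `F₂`, `F₄` and `e^φ = gs`. -/
structure SolvesIIA (S : SU2Structure I M) (kpar gs : ℝ) (Hf : DForm I M ℝ 3)
    (F0 : DForm I M ℝ 0) (F2 : DForm I M ℝ 2) (F4 : DForm I M ℝ 4) : Prop where
  d_reAlpha : S.alpha.re.d = 0
  flux_H : kpar • Hf = kPerp kpar • S.Omega.im.d
  d_perp : (S.reOmegaPerp (angleIIA kpar)).d = (kpar * kPerp kpar) • (S.alpha.re ∧ᵈ S.alpha.im.d)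
  H_wedge_reAlpha : Hf ∧ᵈ S.alpha.re =
    -(kPerp kpar / kpar) • (S.alpha.im ∧ᵈ S.reOmegaPar (angleIIA kpar)).d
  flux_F0 : ∃ G : DForm I M ℝ 6, S.IsHodgeStar (by norm_num) F0 G ∧
    gs • G = ((1 / 2) * kPerp kpar) • (S.alpha.im.d ∧ᵈ (S.Omega.im ∧ᵈ S.Omega.im)) +
      (1 / kpar) • (Hf ∧ᵈ S.alpha.re ∧ᵈ S.reOmegaPar (angleIIA kpar))
  flux_F2 : ∃ G : DForm I M ℝ 4, S.IsHodgeStar (by norm_num) F2 G ∧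
    gs • G = -kpar • (S.alpha.im.d ∧ᵈ S.Omega.im) +
      (1 / kpar) • ((S.reOmegaPar (angleIIA kpar)).d ∧ᵈ S.alpha.re)
  flux_F4 : ∃ G : DForm I M ℝ 2, S.IsHodgeStar (by norm_num) F4 G ∧
    gs • G = -kPerp kpar • S.alpha.im.d

/-- The intermediate `SU(2)` structure `S` with parameter `k_∥` solves the SUSY equations IIB
with fluxes `H`, `F₁`, `F₃`, phase `θ` and `e^φ = gs`. -/
structure SolvesIIB (S : SU2Structure I M) (kpar gs θ : ℝ) (Hf : DForm I M ℝ 3)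
    (F1 : DForm I M ℝ 1) (F3 : DForm I M ℝ 3) : Prop where
  d_reAlpha : S.alpha.re.d = 0
  d_imAlpha : S.alpha.im.d = 0
  flux_H : kpar • Hf = kPerp kpar • S.Omega.im.d
  reAlpha_wedge_H : S.alpha.re ∧ᵈ Hf =
    -(kPerp kpar / kpar) • (S.alpha.im ∧ᵈ (S.reOmegaPerp (angleIIB kpar)).d)
  imAlpha_wedge_H : S.alpha.im ∧ᵈ Hf =
    (kPerp kpar / kpar) • (S.alpha.re ∧ᵈ (S.reOmegaPerp (angleIIB kpar)).d)
  d_par : S.alpha.re ∧ᵈ S.alpha.im ∧ᵈ (S.reOmegaPar (angleIIB kpar)).d = -(Hf ∧ᵈ S.Omega.im)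
  flux_F1 : ∃ G : DForm I M ℝ 5, S.IsHodgeStar (by norm_num) F1 G ∧
    (kPerp kpar * Complex.exp (θ * Complex.I) * gs : ℂ) • G.toComplex =
      (Hf ∧ᵈ S.reOmegaPar (angleIIB kpar)).toComplex
  flux_F3 : ∃ G : DForm I M ℝ 3, S.IsHodgeStar (by norm_num) F3 G ∧
    (kPerp kpar * Complex.exp (θ * Complex.I) * gs : ℂ) • G.toComplex =
      (S.reOmegaPar (angleIIB kpar)).d.toComplex

end SU2

/-- The torus `𝕋²`. -/
abbrev Torus : Type := Circle × Circle

end FluxVacua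

end

open FluxVacua

noncomputable section

namespace FluxVacua

/-! ### Evaluation of wedge products -/

theorem sum_perm_succ {B : Type*} [AddCommMonoid B] {n : ℕ} (F : Equiv.Perm (Fin (n + 1)) → B) :
    ∑ σ, F σ = ∑ p : Fin (n + 1), ∑ σ : Equiv.Perm (Fin n),
      F (Equiv.Perm.decomposeFin.symm (p, σ)) := by
  rw [← Fintype.sum_prod_type', ← Equiv.sum_comp Equiv.Perm.decomposeFin.symm]

theorem sum_sign_smul_two {B : Type*} [AddCommGroup B] (F : Fin 2 → Fin 2 → B) :
    ∑ σ : Equiv.Perm (Fin 2), Equiv.Perm.sign σ • F (σ 0) (σ 1) = F 0 1 - F 1 0 := by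
  rw [show (Finset.univ : Finset (Equiv.Perm (Fin 2))) = {1, Equiv.swap 0 1} by decide]
  rw [Finset.sum_pair (by decide)]
  simp [sub_eq_add_neg]

theorem sum_sign_smul_three {B : Type*} [AddCommGroup B] (F : Fin 3 → Fin 3 → Fin 3 → B) :
    ∑ σ : Equiv.Perm (Fin 3), Equiv.Perm.sign σ • F (σ 0) (σ 1) (σ 2) =
      F 0 1 2 - F 0 2 1 - F 1 0 2 + F 1 2 0 + F 2 0 1 - F 2 1 0 := by
  rw [sum_perm_succ]
  have h : ∀ p : Fin 3, ∑ σ : Equiv.Perm (Fin 2),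
      Equiv.Perm.sign (Equiv.Perm.decomposeFin.symm (p, σ)) •
        F (Equiv.Perm.decomposeFin.symm (p, σ) 0) (Equiv.Perm.decomposeFin.symm (p, σ) 1)
          (Equiv.Perm.decomposeFin.symm (p, σ) 2) =
      (if p = 0 then 1 else -1 : ℤˣ) • (F p (Equiv.swap 0 p 1) (Equiv.swap 0 p 2)
        - F p (Equiv.swap 0 p 2) (Equiv.swap 0 p 1)) := by
    intro p
    refine Eq.trans ?_ (congr_arg _ (sum_sign_smul_two
      (fun i j => F p (Equiv.swap 0 p i.succ) (Equiv.swap 0 p j.succ))))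
    rw [Finset.smul_sum]
    refine Finset.sum_congr rfl fun σ _ => ?_
    rw [Equiv.Perm.decomposeFin.symm_sign, Equiv.Perm.decomposeFin_symm_apply_zero, ← mul_smul]
    exact congr_arg₂ _ rfl (congr_arg₂ _ (Equiv.Perm.decomposeFin_symm_apply_succ σ p 0)
      (Equiv.Perm.decomposeFin_symm_apply_succ σ p 1))
  have e : ∀ G : Fin (2 + 1) → B, ∑ p, G p = G 0 + G 1 + G 2 := fun G => Fin.sum_univ_three G
  simp only [h, e]
  rw [show Equiv.swap (0 : Fin 3) 1 1 = 0 by decide, show Equiv.swap (0 : Fin 3) 1 2 = 2 by decide,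
    show Equiv.swap (0 : Fin 3) 2 1 = 1 by decide, show Equiv.swap (0 : Fin 3) 2 2 = 0 by decide]
  simp
  abel

theorem sum_sign_smul_four {B : Type*} [AddCommGroup B] (F : Fin 4 → Fin 4 → Fin 4 → Fin 4 → B) :
    ∑ σ : Equiv.Perm (Fin 4), Equiv.Perm.sign σ • F (σ 0) (σ 1) (σ 2) (σ 3) =
      (F 0 1 2 3 - F 0 1 3 2 - F 0 2 1 3 + F 0 2 3 1 + F 0 3 1 2 - F 0 3 2 1)
      - (F 1 0 2 3 - F 1 0 3 2 - F 1 2 0 3 + F 1 2 3 0 + F 1 3 0 2 - F 1 3 2 0)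
      + (F 2 0 1 3 - F 2 0 3 1 - F 2 1 0 3 + F 2 1 3 0 + F 2 3 0 1 - F 2 3 1 0)
      - (F 3 0 1 2 - F 3 0 2 1 - F 3 1 0 2 + F 3 1 2 0 + F 3 2 0 1 - F 3 2 1 0) := by
  rw [sum_perm_succ]
  have h : ∀ p : Fin 4, ∑ σ : Equiv.Perm (Fin 3),
      Equiv.Perm.sign (Equiv.Perm.decomposeFin.symm (p, σ)) •
        F (Equiv.Perm.decomposeFin.symm (p, σ) 0) (Equiv.Perm.decomposeFin.symm (p, σ) 1)
          (Equiv.Perm.decomposeFin.symm (p, σ) 2) (Equiv.Perm.decomposeFin.symm (p, σ) 3) =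
      (if p = 0 then 1 else -1 : ℤˣ) •
        ∑ σ : Equiv.Perm (Fin 3), Equiv.Perm.sign σ • F p (Equiv.swap 0 p (σ 0).succ)
          (Equiv.swap 0 p (σ 1).succ) (Equiv.swap 0 p (σ 2).succ) := by
    intro p
    rw [Finset.smul_sum]
    refine Finset.sum_congr rfl fun σ _ => ?_
    rw [Equiv.Perm.decomposeFin.symm_sign, Equiv.Perm.decomposeFin_symm_apply_zero, ← mul_smul,
      ← Equiv.Perm.decomposeFin_symm_apply_succ σ p 0,
      ← Equiv.Perm.decomposeFin_symm_apply_succ σ p 1,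
      ← Equiv.Perm.decomposeFin_symm_apply_succ σ p 2]
    rfl
  have e : ∀ G : Fin (3 + 1) → B, ∑ p, G p = G 0 + G 1 + G 2 + G 3 :=
    fun G => Fin.sum_univ_four G
  simp only [h, e]
  simp only [fun p : Fin 4 => sum_sign_smul_three (fun i j k => F p (Equiv.swap 0 p i.succ)
    (Equiv.swap 0 p j.succ) (Equiv.swap 0 p k.succ))]
  rw [show (0 : Fin 3).succ = (1 : Fin 4) by rfl, show (1 : Fin 3).succ = (2 : Fin 4) by rfl,
    show (2 : Fin 3).succ = (3 : Fin 4) by rfl,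
    show Equiv.swap (0 : Fin 4) 1 1 = 0 by decide, show Equiv.swap (0 : Fin 4) 1 2 = 2 by decide,
    show Equiv.swap (0 : Fin 4) 1 3 = 3 by decide,
    show Equiv.swap (0 : Fin 4) 2 1 = 1 by decide, show Equiv.swap (0 : Fin 4) 2 2 = 0 by decide,
    show Equiv.swap (0 : Fin 4) 2 3 = 3 by decide,
    show Equiv.swap (0 : Fin 4) 3 1 = 1 by decide, show Equiv.swap (0 : Fin 4) 3 2 = 2 by decide,
    show Equiv.swap (0 : Fin 4) 3 3 = 0 by decide]
  simp
  abel

section Eval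

variable {V : Type*} [AddCommGroup V] [Module ℝ V] [TopologicalSpace V]
  {A : Type*} [NormedCommRing A] [NormedAlgebra ℝ A]

theorem apply_one_eq {W A : Type*} (f : (Fin 1 → W) → A) (w : Fin 1 → W) : f w = f ![w 0] := by
  congr 1; ext i; fin_cases i; rfl

theorem apply_two_eq {W A : Type*} (f : (Fin 2 → W) → A) (w : Fin 2 → W) :
    f w = f ![w 0, w 1] := by
  congr 1; ext i; fin_cases i <;> rfl

theorem altForm_two_swap (f : V [⋀^Fin 2]→L[ℝ] A) (u v : V) :
    f ![u, v] = -f ![v, u] := by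
  have := f.map_swap ![v, u] (i := 0) (j := 1) (by decide)
  refine Eq.trans ?_ this
  change f _ = f _
  congr 1
  ext i; fin_cases i <;> rfl

variable [IsTopologicalAddGroup V] [ContinuousConstSMul ℝ V]

theorem wedgeAlt_one_one_apply (f g : V [⋀^Fin 1]→L[ℝ] A) (v : Fin 2 → V) :
    wedgeAlt f g v = f ![v 0] * g ![v 1] - f ![v 1] * g ![v 0] := by
  rw [wedgeAlt_apply, ← sum_sign_smul_two (fun i j => f ![v i] * g ![v j])]
  simp only [Nat.factorial, Nat.cast_one, mul_one, inv_one, one_smul]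
  refine Finset.sum_congr rfl fun σ _ => ?_
  rw [apply_one_eq f, apply_one_eq g]
  rfl

theorem wedgeAlt_one_two_apply (f : V [⋀^Fin 1]→L[ℝ] A) (g : V [⋀^Fin 2]→L[ℝ] A)
    (v : Fin 3 → V) :
    wedgeAlt f g v = f ![v 0] * g ![v 1, v 2] - f ![v 1] * g ![v 0, v 2]
      + f ![v 2] * g ![v 0, v 1] := by
  have h := sum_sign_smul_three (fun i j k => f ![v i] * g ![v j, v k])
  rw [altForm_two_swap g (v 2) (v 1), altForm_two_swap g (v 2) (v 0),
    altForm_two_swap g (v 1) (v 0)] at h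
  have h' : ∑ σ : Equiv.Perm (Fin 3), Equiv.Perm.sign σ • (f ![v (σ 0)] * g ![v (σ 1), v (σ 2)]) =
      (2 : ℝ) • (f ![v 0] * g ![v 1, v 2] - f ![v 1] * g ![v 0, v 2]
      + f ![v 2] * g ![v 0, v 1]) := by
    rw [h, two_smul]; ring
  rw [wedgeAlt_apply, ← one_smul ℝ (_ + _ : A), show (1 : ℝ) = (2 : ℝ)⁻¹ * 2 by norm_num,
    mul_smul, ← h']
  congr 1
  · norm_num [Nat.factorial]
  · refine Finset.sum_congr rfl fun σ _ => ?_
    rw [apply_one_eq f, apply_two_eq g]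
    rfl

theorem wedgeAlt_two_two_apply (f g : V [⋀^Fin 2]→L[ℝ] A) (v : Fin 4 → V) :
    wedgeAlt f g v =
      f ![v 0, v 1] * g ![v 2, v 3] - f ![v 0, v 2] * g ![v 1, v 3]
      + f ![v 0, v 3] * g ![v 1, v 2] + f ![v 1, v 2] * g ![v 0, v 3]
      - f ![v 1, v 3] * g ![v 0, v 2] + f ![v 2, v 3] * g ![v 0, v 1] := by
  have h := sum_sign_smul_four (fun i j k l => f ![v i, v j] * g ![v k, v l])
  rw [altForm_two_swap g (v 2) (v 1), altForm_two_swap g (v 2) (v 0),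
    altForm_two_swap g (v 1) (v 0), altForm_two_swap g (v 3) (v 0),
    altForm_two_swap g (v 3) (v 1), altForm_two_swap g (v 3) (v 2),
    altForm_two_swap f (v 2) (v 1), altForm_two_swap f (v 2) (v 0),
    altForm_two_swap f (v 1) (v 0), altForm_two_swap f (v 3) (v 0),
    altForm_two_swap f (v 3) (v 1), altForm_two_swap f (v 3) (v 2)] at h
  have h' : ∑ σ : Equiv.Perm (Fin 4),
      Equiv.Perm.sign σ • (f ![v (σ 0), v (σ 1)] * g ![v (σ 2), v (σ 3)]) =
      (4 : ℝ) • (f ![v 0, v 1] * g ![v 2, v 3] - f ![v 0, v 2] * g ![v 1, v 3]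
      + f ![v 0, v 3] * g ![v 1, v 2] + f ![v 1, v 2] * g ![v 0, v 3]
      - f ![v 1, v 3] * g ![v 0, v 2] + f ![v 2, v 3] * g ![v 0, v 1]) := by
    rw [h, Algebra.smul_def, map_ofNat]; ring
  rw [wedgeAlt_apply, ← one_smul ℝ (_ + _ : A), show (1 : ℝ) = (4 : ℝ)⁻¹ * 4 by norm_num,
    mul_smul, ← h']
  congr 1
  · norm_num [Nat.factorial]
  · refine Finset.sum_congr rfl fun σ _ => ?_
    rw [apply_two_eq f, apply_two_eq g]
    rfl

@[simp]
theorem wedgeAlt_zero_left {k l : ℕ} (g : V [⋀^Fin l]→L[ℝ] A) :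
    wedgeAlt (0 : V [⋀^Fin k]→L[ℝ] A) g = 0 := by
  ext v
  rw [wedgeAlt_apply]
  simp

@[simp]
theorem wedgeAlt_zero_right {k l : ℕ} (f : V [⋀^Fin k]→L[ℝ] A) :
    wedgeAlt f (0 : V [⋀^Fin l]→L[ℝ] A) = 0 := by
  ext v
  rw [wedgeAlt_apply]
  simp

theorem wedgeAlt_compContinuousLinearMap {W : Type*} [AddCommGroup W] [Module ℝ W]
    [TopologicalSpace W] [IsTopologicalAddGroup W] [ContinuousConstSMul ℝ W] {k l : ℕ}
    (f : V [⋀^Fin k]→L[ℝ] A) (g : V [⋀^Fin l]→L[ℝ] A) (L : W →L[ℝ] V) :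
    wedgeAlt (f.compContinuousLinearMap L) (g.compContinuousLinearMap L) =
      (wedgeAlt f g).compContinuousLinearMap L := by
  ext v
  rw [ContinuousAlternatingMap.compContinuousLinearMap_apply, wedgeAlt_apply, wedgeAlt_apply]
  rfl

/-- The matrix of the standard symplectic form of `ℝ⁶`. -/
def stdSymplectic : Fin 6 → Fin 6 → ℤ :=
  ![![0, 1, 0, 0, 0, 0], ![-1, 0, 0, 0, 0, 0], ![0, 0, 0, 1, 0, 0], ![0, 0, -1, 0, 0, 0],
    ![0, 0, 0, 0, 0, 1], ![0, 0, 0, 0, -1, 0]]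

theorem sum_sign_stdSymplectic :
    (∑ σ : Equiv.Perm (Fin 6), Equiv.Perm.sign σ •
      ((2 * (stdSymplectic (σ 0) (σ 1) * stdSymplectic (σ 2) (σ 3)
        - stdSymplectic (σ 0) (σ 2) * stdSymplectic (σ 1) (σ 3)
        + stdSymplectic (σ 0) (σ 3) * stdSymplectic (σ 1) (σ 2)))
        * stdSymplectic (σ 4) (σ 5))) = 288 := by
  decide +kernel

theorem wedgeAlt_cube_apply (F : V [⋀^Fin 2]→L[ℝ] ℝ) (v : Fin 6 → V)
    (h : ∀ i j, F ![v i, v j] = stdSymplectic i j) :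
    wedgeAlt (wedgeAlt F F) F v = 6 := by
  rw [wedgeAlt_apply]
  have key : ∀ σ : Equiv.Perm (Fin 6), Equiv.Perm.sign σ •
      (wedgeAlt F F (fun i => v (σ (Fin.castAdd 2 i))) * F (fun j => v (σ (Fin.natAdd 4 j)))) =
      ((Equiv.Perm.sign σ •
      ((2 * (stdSymplectic (σ 0) (σ 1) * stdSymplectic (σ 2) (σ 3)
        - stdSymplectic (σ 0) (σ 2) * stdSymplectic (σ 1) (σ 3)
        + stdSymplectic (σ 0) (σ 3) * stdSymplectic (σ 1) (σ 2)))
        * stdSymplectic (σ 4) (σ 5)) : ℤ) : ℝ) := by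
    intro σ
    rw [wedgeAlt_two_two_apply, apply_two_eq F fun j => v (σ (Fin.natAdd 4 j))]
    simp only [h, Units.smul_def, smul_eq_mul, zsmul_eq_mul, Int.cast_mul, Int.cast_add,
      Int.cast_sub, Int.cast_ofNat]
    change _ * ((stdSymplectic (σ 0) (σ 1) * stdSymplectic (σ 2) (σ 3)
        - stdSymplectic (σ 0) (σ 2) * stdSymplectic (σ 1) (σ 3)
        + stdSymplectic (σ 0) (σ 3) * stdSymplectic (σ 1) (σ 2)
        + stdSymplectic (σ 1) (σ 2) * stdSymplectic (σ 0) (σ 3)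
        - stdSymplectic (σ 1) (σ 3) * stdSymplectic (σ 0) (σ 2)
        + stdSymplectic (σ 2) (σ 3) * stdSymplectic (σ 0) (σ 1) : ℝ)
        * stdSymplectic (σ 4) (σ 5)) = _
    ring
  have hs := congr_arg (fun n : ℤ => (n : ℝ)) sum_sign_stdSymplectic
  rw [Int.cast_sum] at hs
  change _ • ∑ σ : Equiv.Perm (Fin 6), Equiv.Perm.sign σ •
      (wedgeAlt F F (fun i => v (σ (Fin.castAdd 2 i))) * F (fun j => v (σ (Fin.natAdd 4 j)))) = _
  rw [Finset.sum_congr rfl fun σ _ => key σ, hs]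
  norm_num [Nat.factorial]

end Eval

/-! ### Smoothness of forms through their values -/

section Injective

variable {V W : Type*} [NormedAddCommGroup V] [NormedSpace ℝ V]
  [NormedAddCommGroup W] [NormedSpace ℝ W] [FiniteDimensional ℝ W]
  {E : Type*} [NormedAddCommGroup E] [NormedSpace ℝ E]
  {H : Type*} [TopologicalSpace H] {I : ModelWithCorners ℝ E H}
  {M : Type*} [TopologicalSpace M] [ChartedSpace H M] {n : WithTop ℕ∞}

theorem contMDiffWithinAt_of_injective_comp (Ψ : V →ₗ[ℝ] W) (hΨ : Function.Injective Ψ)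
    {f : M → V} {s : Set M} {x : M}
    (hf : ContMDiffWithinAt I 𝓘(ℝ, W) n (fun y => Ψ (f y)) s x) :
    ContMDiffWithinAt I 𝓘(ℝ, V) n f s x := by
  obtain ⟨g, hg⟩ := Ψ.exists_leftInverse_of_injective (LinearMap.ker_eq_bot.2 hΨ)
  have h := (LinearMap.toContinuousLinearMap g).contMDiff (n := n)
    |>.contMDiffAt.comp_contMDiffWithinAt x hf
  refine h.congr_of_eventuallyEq (.of_forall fun y => ?_) ?_
  · exact (LinearMap.congr_fun hg (f y)).symm
  · exact (LinearMap.congr_fun hg (f x)).symm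

variable {F : Type*} [NormedAddCommGroup F] [NormedSpace ℝ F] [FiniteDimensional ℝ F]
  {A : Type*} [NormedAddCommGroup A] [NormedSpace ℝ A] [FiniteDimensional ℝ A]

theorem contMDiffWithinAt_clm_of_apply {f : M → F →L[ℝ] A} {s : Set M} {x : M}
    (hf : ∀ v, ContMDiffWithinAt I 𝓘(ℝ, A) n (fun y => f y v) s x) :
    ContMDiffWithinAt I 𝓘(ℝ, F →L[ℝ] A) n f s x := by
  let b := Module.finBasis ℝ F
  let Ψ : (F →L[ℝ] A) →ₗ[ℝ] (Fin (Module.finrank ℝ F) → A) :=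
    { toFun := fun f i => f (b i), map_add' := fun _ _ => rfl, map_smul' := fun _ _ => rfl }
  refine contMDiffWithinAt_of_injective_comp Ψ (fun f g h => ?_) ?_
  · exact ContinuousLinearMap.coe_injective (b.ext fun i => congr_fun h i)
  · exact contMDiffWithinAt_pi_space.2 fun i => hf (b i)

theorem contDiffWithinAt_alt_of_apply {k : ℕ} {f : E → F [⋀^Fin k]→L[ℝ] A} {s : Set E} {x : E}
    (hf : ∀ v, ContDiffWithinAt ℝ n (fun y => f y v) s x) :
    ContDiffWithinAt ℝ n f s x := by
  let b := Module.finBasis ℝ F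
  let Ψ : (F [⋀^Fin k]→L[ℝ] A) →ₗ[ℝ] ((Fin k → Fin (Module.finrank ℝ F)) → A) :=
    { toFun := fun f (i : Fin k → Fin (Module.finrank ℝ F)) => f (fun j => b (i j))
      map_add' := fun _ _ => rfl
      map_smul' := fun _ _ => rfl }
  refine (contMDiffWithinAt_of_injective_comp (I := 𝓘(ℝ, E)) Ψ (fun f g h => ?_)
    ?_).contDiffWithinAt
  · refine ContinuousAlternatingMap.toAlternatingMap_injective ?_
    exact Module.Basis.ext_alternating b fun i _ => congr_fun h i
  · exact (contDiffWithinAt_pi.2 fun (i : Fin k → Fin (Module.finrank ℝ F)) =>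
      hf fun j => b (i j)).contMDiffWithinAt

end Injective

/-! ### Chart expressions and the exterior derivative -/

section Calculus

variable {E : Type*} [NormedAddCommGroup E] [NormedSpace ℝ E]
  {H : Type*} [TopologicalSpace H] {I : ModelWithCorners ℝ E H}
  {M : Type*} [TopologicalSpace M] [ChartedSpace H M]
  {A : Type*} [NormedCommRing A] [NormedAlgebra ℝ A] {k l : ℕ}

theorem DForm.chartRep_apply (α : DForm I M A k) (x₀ : M) (y : E) (v : Fin k → E) :
    α.chartRep x₀ y v = α ((extChartAt I x₀).symm y)
      (fun i => mfderivWithin 𝓘(ℝ, E) I (extChartAt I x₀).symm (Set.range I) y (v i)) := rfl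

theorem DForm.chartRep_wedge (α : DForm I M A k) (β : DForm I M A l) (x₀ : M) (y : E) :
    (α ∧ᵈ β).chartRep x₀ y = wedgeAlt (α.chartRep x₀ y) (β.chartRep x₀ y) :=
  (wedgeAlt_compContinuousLinearMap _ _ _).symm

theorem DForm.isSmooth_of_apply [FiniteDimensional ℝ E] [FiniteDimensional ℝ A]
    {α : DForm I M A k}
    (h : ∀ (x₀ : M) (v : Fin k → E),
      ContDiffOn ℝ ∞ (fun y => α.chartRep x₀ y v) (extChartAt I x₀).target) : α.IsSmooth :=
  fun x₀ y hy => contDiffWithinAt_alt_of_apply fun v => h x₀ v y hy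

theorem DForm.IsSmooth.contDiffOn_apply {α : DForm I M A k} (h : α.IsSmooth) (x₀ : M)
    (v : Fin k → E) :
    ContDiffOn ℝ ∞ (fun y => α.chartRep x₀ y v) (extChartAt I x₀).target :=
  (ContinuousAlternatingMap.apply ℝ E A v).contDiff.comp_contDiffOn (h x₀)

theorem DForm.IsSmooth.smul {α : DForm I M A k} (h : α.IsSmooth) (c : ℝ) : (c • α).IsSmooth :=
  fun x => (h x).const_smul c

variable {E' : Type*} [NormedAddCommGroup E'] [NormedSpace ℝ E']
  {H' : Type*} [TopologicalSpace H'] {I' : ModelWithCorners ℝ E' H'}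
  {M' : Type*} [TopologicalSpace M'] [ChartedSpace H' M']

/-- The map `f` is expressed in the preferred charts by the continuous linear map `L`. -/
structure IsLinearInCharts (I : ModelWithCorners ℝ E H) (I' : ModelWithCorners ℝ E' H')
    (f : M → M') (L : E →L[ℝ] E') : Prop where
  mdifferentiable : MDifferentiable I I' f
  mapsTo : ∀ x, ∀ y ∈ (extChartAt I x).target, L y ∈ (extChartAt I' (f x)).target
  comm : ∀ x y, f ((extChartAt I x).symm y) = (extChartAt I' (f x)).symm (L y)
  center : ∀ x, L (extChartAt I x x) = extChartAt I' (f x) (f x)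

theorem isLinearInCharts_fst : IsLinearInCharts (I.prod I') I (Prod.fst : M × M' → M)
    (ContinuousLinearMap.fst ℝ E E') where
  mdifferentiable := mdifferentiable_fst
  mapsTo x y hy := by
    rw [extChartAt_prod] at hy
    exact hy.1
  comm x y := by rw [extChartAt_prod]; rfl
  center x := by rw [extChartAt_prod]; rfl

theorem isLinearInCharts_snd : IsLinearInCharts (I.prod I') I' (Prod.snd : M × M' → M')
    (ContinuousLinearMap.snd ℝ E E') where
  mdifferentiable := mdifferentiable_snd
  mapsTo x y hy := by
    rw [extChartAt_prod] at hy
    exact hy.2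
  comm x y := by rw [extChartAt_prod]; rfl
  center x := by rw [extChartAt_prod]; rfl

variable [I.Boundaryless]

theorem DForm.IsSmooth.differentiableAt {α : DForm I M A k} (h : α.IsSmooth) (x : M) :
    DifferentiableAt ℝ (α.chartRep x) (extChartAt I x x) :=
  ((h x).contDiffAt ((isOpen_extChartAt_target x).mem_nhds (mem_extChartAt_target x))
    ).differentiableAt (by simp)

theorem DForm.extDeriv_two_apply {w : DForm I M ℝ 2} (hw : w.IsSmooth) (x : M) (p q r : E) :
    extDeriv (w.chartRep x) (extChartAt I x x) ![p, q, r] =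
    fderiv ℝ (fun y => w.chartRep x y ![q, r]) (extChartAt I x x) p -
      fderiv ℝ (fun y => w.chartRep x y ![p, r]) (extChartAt I x x) q +
      fderiv ℝ (fun y => w.chartRep x y ![p, q]) (extChartAt I x x) r := by
  refine ((extDeriv_apply (hw.differentiableAt x) _).trans (Fin.sum_univ_three _)).trans ?_
  have e0 : (0 : Fin 3).removeNth ![p, q, r] = ![q, r] := by ext i; fin_cases i <;> rfl
  have e1 : (1 : Fin 3).removeNth ![p, q, r] = ![p, r] := by ext i; fin_cases i <;> rfl
  have e2 : (2 : Fin 3).removeNth ![p, q, r] = ![p, q] := by ext i; fin_cases i <;> rfl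
  rw [e0, e1, e2]
  simp
  ring

theorem DForm.d_smul (c : ℝ) (α : DForm I M A k) : (c • α).d = c • α.d := by
  funext x
  have h : (c • α).chartRep x = c • α.chartRep x := rfl
  simp only [DForm.d, Pi.smul_apply, h]
  rw [extDerivWithin_smul _ _ (by simp [I.range_eq_univ])]
  rfl

theorem DForm.IsClosedForm.smul {α : DForm I M A k} (h : α.IsClosedForm) (c : ℝ) :
    (c • α).IsClosedForm := by
  rw [DForm.IsClosedForm] at h ⊢
  rw [DForm.d_smul, h]
  exact funext fun x => smul_zero (A := TangentSpace I x [⋀^Fin (k + 1)]→L[ℝ] A) c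

variable [IsManifold I 1 M]

theorem DForm.d_eq_zero_iff (α : DForm I M A k) :
    α.d = 0 ↔ ∀ x, extDeriv (α.chartRep x) (extChartAt I x x) = 0 := by
  constructor
  · intro h x
    have hx := congr_fun h x
    simp only [DForm.d, I.range_eq_univ, extDerivWithin_univ, mfderiv_extChartAt_self] at hx
    exact hx
  · intro h
    funext x
    simp only [DForm.d, I.range_eq_univ, extDerivWithin_univ, h]
    rfl

variable [I'.Boundaryless] [IsManifold I' 1 M']

theorem DForm.chartRep_pullback {f : M → M'} {L : E →L[ℝ] E'} (hf : IsLinearInCharts I I' f L)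
    (α : DForm I' M' A k) (x : M) {y : E} (hy : y ∈ (extChartAt I x).target) :
    (α.pullback f : DForm I M A k).chartRep x y =
      (α.chartRep (f x) (L y)).compContinuousLinearMap L := by
  have key : ∀ (p p' : M') (_ : p = p') (w : Fin k → E'),
      (α p : E' [⋀^Fin k]→L[ℝ] A) w = (α p' : E' [⋀^Fin k]→L[ℝ] A) w := by
    rintro p _ rfl w; rfl
  have hs : MDifferentiableAt 𝓘(ℝ, E) I (extChartAt I x).symm y := by
    have := mdifferentiableWithinAt_extChartAt_symm (I := I) hy
    rwa [I.range_eq_univ, mdifferentiableWithinAt_univ] at this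
  have hs' : MDifferentiableAt 𝓘(ℝ, E') I' (extChartAt I' (f x)).symm (L y) := by
    have := mdifferentiableWithinAt_extChartAt_symm (I := I') (hf.mapsTo x y hy)
    rwa [I'.range_eq_univ, mdifferentiableWithinAt_univ] at this
  have h1 := mfderiv_comp y (hf.mdifferentiable _) hs
  have h2 := mfderiv_comp (I := 𝓘(ℝ, E)) y hs' L.mdifferentiableAt
  have h3 : f ∘ (extChartAt I x).symm = (extChartAt I' (f x)).symm ∘ L :=
    funext fun z => hf.comm x z
  have h4 : mfderiv 𝓘(ℝ, E) 𝓘(ℝ, E') L y = L := by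
    rw [mfderiv_eq_fderiv]; exact L.fderiv
  ext v
  rw [DForm.chartRep_apply, ContinuousAlternatingMap.compContinuousLinearMap_apply,
    DForm.chartRep_apply, I.range_eq_univ, I'.range_eq_univ]
  simp only [mfderivWithin_univ]
  refine (key _ _ (hf.comm x y) _).trans ?_
  congr 1
  funext i
  have h5 : (mfderiv 𝓘(ℝ, E) I' (f ∘ (extChartAt I x).symm) y : E →L[ℝ] E') (v i) =
    (mfderiv 𝓘(ℝ, E) I' ((extChartAt I' (f x)).symm ∘ L) y : E →L[ℝ] E') (v i) := by
    rw [h3]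
  rw [h1, h2, h4] at h5
  exact h5

theorem DForm.IsSmooth.pullback [FiniteDimensional ℝ E] [FiniteDimensional ℝ A]
    {f : M → M'} {L : E →L[ℝ] E'} (hf : IsLinearInCharts I I' f L)
    {α : DForm I' M' A k} (h : α.IsSmooth) : (α.pullback f : DForm I M A k).IsSmooth :=
  DForm.isSmooth_of_apply fun x v =>
    ((h.contDiffOn_apply (f x) fun i => L (v i)).comp L.contDiff.contDiffOn
      (hf.mapsTo x)).congr fun y hy => by rw [DForm.chartRep_pullback hf α x hy]; rfl

theorem DForm.IsClosedForm.pullback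
    {f : M → M'} {L : E →L[ℝ] E'} (hf : IsLinearInCharts I I' f L)
    {α : DForm I' M' A k} (hs : α.IsSmooth) (h : α.IsClosedForm) :
    (α.pullback f : DForm I M A k).IsClosedForm := by
  rw [DForm.IsClosedForm, DForm.d_eq_zero_iff] at h ⊢
  intro x
  have e : (α.pullback f : DForm I M A k).chartRep x =ᶠ[nhds (extChartAt I x x)]
      fun y => (α.chartRep (f x) (L y)).compContinuousLinearMap (fderiv ℝ L y) := by
    filter_upwards [(isOpen_extChartAt_target x).mem_nhds (mem_extChartAt_target x)] with y hy
    rw [DForm.chartRep_pullback hf α x hy, L.fderiv]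
  rw [e.extDeriv_eq, extDeriv_pullback (r := ∞) _ L.contDiff.contDiffAt (by
    rw [minSmoothness_of_isRCLikeNormedField]; exact ENat.LEInfty.out),
    hf.center, h]
  · rfl
  · rw [hf.center]; exact hs.differentiableAt (f x)

theorem DForm.IsSmooth.fderiv_apply_symm {a : DForm I M ℝ 1} (ha : a.IsSmooth)
    (h : a.IsClosedForm) (x : M) (u v : E) :
    fderiv ℝ (fun y => a.chartRep x y ![v]) (extChartAt I x x) u =
      fderiv ℝ (fun y => a.chartRep x y ![u]) (extChartAt I x x) v := by
  have := (((extDeriv_apply (ha.differentiableAt x) ![u, v]).trans (Fin.sum_univ_two _)).symm.trans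
    (congr_arg (fun f => f ![u, v]) ((DForm.d_eq_zero_iff a).1 h x)))
  have e0 : (0 : Fin 2).removeNth ![u, v] = ![v] := by ext i; fin_cases i; rfl
  have e1 : (1 : Fin 2).removeNth ![u, v] = ![u] := by ext i; fin_cases i; rfl
  rw [e0, e1] at this
  change (-1 : ℤ) ^ 0 • fderiv ℝ (fun y => a.chartRep x y ![v]) _ u +
    (-1 : ℤ) ^ 1 • fderiv ℝ (fun y => a.chartRep x y ![u]) _ v = 0 at this
  rw [pow_zero, pow_one, one_smul, neg_smul, one_smul] at this
  linarith

theorem DForm.IsClosedForm.wedge_one_two [FiniteDimensional ℝ E]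
    {a : DForm I M ℝ 1} {w : DForm I M ℝ 2} (ha : a.IsSmooth)
    (hw : w.IsSmooth) (hac : a.IsClosedForm) (hwc : w.IsClosedForm) :
    (a ∧ᵈ w).IsClosedForm := by
  rw [DForm.IsClosedForm, DForm.d_eq_zero_iff]
  intro x
  have hc : (a ∧ᵈ w).chartRep x = fun y => wedgeAlt (a.chartRep x y) (w.chartRep x y) :=
    funext fun y => DForm.chartRep_wedge a w x y
  have da : ∀ v, DifferentiableAt ℝ (fun y => a.chartRep x y v) (extChartAt I x x) := fun v =>
    (ContinuousAlternatingMap.apply ℝ E ℝ v).differentiableAt.comp _ (ha.differentiableAt x)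
  have dw : ∀ v, DifferentiableAt ℝ (fun y => w.chartRep x y v) (extChartAt I x x) := fun v =>
    (ContinuousAlternatingMap.apply ℝ E ℝ v).differentiableAt.comp _ (hw.differentiableAt x)
  have hsm : (a ∧ᵈ w).IsSmooth := DForm.isSmooth_of_apply fun x₀ v => by
    simp only [DForm.chartRep_wedge, wedgeAlt_one_two_apply]
    exact (((ha.contDiffOn_apply x₀ _).mul (hw.contDiffOn_apply x₀ _)).sub
      ((ha.contDiffOn_apply x₀ _).mul (hw.contDiffOn_apply x₀ _))).add
      ((ha.contDiffOn_apply x₀ _).mul (hw.contDiffOn_apply x₀ _))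
  have hd := hsm.differentiableAt x
  have hf : ∀ (p q r u : E), fderiv ℝ (fun y => (a ∧ᵈ w).chartRep x y ![p, q, r])
      (extChartAt I x x) u =
      (fderiv ℝ (fun y => a.chartRep x y ![p]) (extChartAt I x x) u *
        w.chartRep x (extChartAt I x x) ![q, r] +
        a.chartRep x (extChartAt I x x) ![p] *
        fderiv ℝ (fun y => w.chartRep x y ![q, r]) (extChartAt I x x) u) -
      (fderiv ℝ (fun y => a.chartRep x y ![q]) (extChartAt I x x) u *
        w.chartRep x (extChartAt I x x) ![p, r] +
        a.chartRep x (extChartAt I x x) ![q] *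
        fderiv ℝ (fun y => w.chartRep x y ![p, r]) (extChartAt I x x) u) +
      (fderiv ℝ (fun y => a.chartRep x y ![r]) (extChartAt I x x) u *
        w.chartRep x (extChartAt I x x) ![p, q] +
        a.chartRep x (extChartAt I x x) ![r] *
        fderiv ℝ (fun y => w.chartRep x y ![p, q]) (extChartAt I x x) u) := by
    intro p q r u
    simp only [hc, wedgeAlt_one_two_apply]
    have := ((((da ![p]).hasFDerivAt.mul (dw ![q, r]).hasFDerivAt).sub
      ((da ![q]).hasFDerivAt.mul (dw ![p, r]).hasFDerivAt)).add
      ((da ![r]).hasFDerivAt.mul (dw ![p, q]).hasFDerivAt)).fderiv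
    refine (congr_arg (fun f => f u) this).trans ?_
    simp
    ring
  ext v
  have e : v = ![v 0, v 1, v 2, v 3] := by ext i; fin_cases i <;> rfl
  generalize v 0 = p at e
  generalize v 1 = q at e
  generalize v 2 = r at e
  generalize v 3 = s at e
  subst e
  have e0 : (0 : Fin 4).removeNth ![p, q, r, s] = ![q, r, s] := by ext i; fin_cases i <;> rfl
  have e1 : (1 : Fin 4).removeNth ![p, q, r, s] = ![p, r, s] := by ext i; fin_cases i <;> rfl
  have e2 : (2 : Fin 4).removeNth ![p, q, r, s] = ![p, q, s] := by ext i; fin_cases i <;> rfl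
  have e3 : (3 : Fin 4).removeNth ![p, q, r, s] = ![p, q, r] := by ext i; fin_cases i <;> rfl
  have hw0 : ∀ p q r : E, _ := fun p q r => (DForm.extDeriv_two_apply hw x p q r).symm.trans
    (congr_arg (fun f => f ![p, q, r]) ((DForm.d_eq_zero_iff w).1 hwc x))
  simp only [ContinuousAlternatingMap.coe_zero, Pi.zero_apply] at hw0
  refine ((extDeriv_apply hd _).trans (Fin.sum_univ_four _)).trans ?_
  rw [e0, e1, e2, e3]
  change (-1 : ℤ) ^ 0 • fderiv ℝ (fun y => (a ∧ᵈ w).chartRep x y ![q, r, s]) _ p +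
    (-1 : ℤ) ^ 1 • fderiv ℝ (fun y => (a ∧ᵈ w).chartRep x y ![p, r, s]) _ q +
    (-1 : ℤ) ^ 2 • fderiv ℝ (fun y => (a ∧ᵈ w).chartRep x y ![p, q, s]) _ r +
    (-1 : ℤ) ^ 3 • fderiv ℝ (fun y => (a ∧ᵈ w).chartRep x y ![p, q, r]) _ s = 0
  rw [show (-1 : ℤ) ^ 2 = 1 by norm_num, show (-1 : ℤ) ^ 3 = -1 by norm_num, pow_zero, pow_one,
    one_smul, one_smul, neg_smul, neg_smul, one_smul, one_smul]
  rw [hf, hf, hf, hf, ha.fderiv_apply_symm hac x p q, ha.fderiv_apply_symm hac x p r,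
    ha.fderiv_apply_symm hac x p s, ha.fderiv_apply_symm hac x q r,
    ha.fderiv_apply_symm hac x q s, ha.fderiv_apply_symm hac x r s]
  have t1 := hw0 q r s
  have t2 := hw0 p r s
  have t3 := hw0 p q s
  have t4 := hw0 p q r
  generalize a.chartRep x (extChartAt I x x) ![p] = ap at *
  generalize a.chartRep x (extChartAt I x x) ![q] = aq at *
  generalize a.chartRep x (extChartAt I x x) ![r] = ar at *
  generalize a.chartRep x (extChartAt I x x) ![s] = as at *
  linear_combination (-ap) * t1 + aq * t2 - ar * t3 + as * t4

end Calculus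

/-! ### Coordinate vector fields -/

section ChartField

variable {E : Type*} [NormedAddCommGroup E] [NormedSpace ℝ E]
  {H : Type*} [TopologicalSpace H] {I : ModelWithCorners ℝ E H}
  {N : Type*} [TopologicalSpace N] [ChartedSpace H N] [IsManifold I ∞ N]

/-- The vector field with constant coordinates `v` in the preferred chart around `x₀`. -/
def chartField (I : ModelWithCorners ℝ E H) {N : Type*} [TopologicalSpace N] [ChartedSpace H N]
    [IsManifold I ∞ N] (x₀ : N) (v : E) : (z : N) → TangentSpace I z :=
  fun z => (trivializationAt E (TangentSpace I) x₀).symmL ℝ z v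

theorem contMDiffAt_chartField (x₀ : N) (v : E) {z : N} (hz : z ∈ (chartAt H x₀).source) :
    ContMDiffAt I (I.prod 𝓘(ℝ, E)) ∞
      (fun z => TotalSpace.mk' E z (chartField I x₀ v z)) z := by
  have hz' : z ∈ (trivializationAt E (TangentSpace I : N → Type _) x₀).baseSet := by
    rwa [TangentBundle.trivializationAt_baseSet]
  rw [(trivializationAt E (TangentSpace I) x₀).contMDiffAt_section_iff hz']
  refine (contMDiffAt_const (c := v)).congr_of_eventuallyEq ?_
  filter_upwards [(trivializationAt E (TangentSpace I) x₀).open_baseSet.mem_nhds hz'] with w hw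
  simp only [chartField]
  have := (trivializationAt E (TangentSpace I : N → Type _) x₀).continuousLinearMapAt_symmL
    (R := ℝ) hw v
  rwa [Trivialization.continuousLinearMapAt_apply, Trivialization.linearMapAt_apply,
    if_pos hw] at this

theorem chartField_symm (x₀ : N) (v : E) {y : E} (hy : y ∈ (extChartAt I x₀).target) :
    chartField I x₀ v ((extChartAt I x₀).symm y) =
      mfderivWithin 𝓘(ℝ, E) I (extChartAt I x₀).symm (Set.range I) y v := by
  have h : (extChartAt I x₀).symm y ∈ (chartAt H x₀).source := by
    rw [← extChartAt_source I]; exact (extChartAt I x₀).map_target hy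
  rw [chartField, TangentBundle.symmL_trivializationAt h, (extChartAt I x₀).right_inv hy]
  rfl

theorem chartField_self (x : N) (v : E) : chartField I x v x = v := by
  rw [chartField, TangentBundle.symmL_trivializationAt (mem_chart_source H x),
    mfderivWithin_range_extChartAt_symm]
  rfl

variable [I.Boundaryless]

theorem mlieBracket_chartField (x : N) (u v : E) :
    VectorField.mlieBracket I (chartField I x u) (chartField I x v) x = 0 := by
  have h : ∀ w : E, VectorField.mpullbackWithin 𝓘(ℝ, E) I (extChartAt I x).symm
      (chartField I x w) (Set.range I) =ᶠ[nhds (extChartAt I x x)] fun _ => w := by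
    intro w
    filter_upwards [(isOpen_extChartAt_target x).mem_nhds (mem_extChartAt_target x)] with y hy
    rw [VectorField.mpullbackWithin_apply, chartField_symm x w hy]
    exact (isInvertible_mfderivWithin_extChartAt_symm hy).inverse_apply_eq.2 rfl
  rw [← VectorField.mlieBracketWithin_univ, VectorField.mlieBracketWithin_apply]
  rw [Filter.EventuallyEq.lieBracketWithin_vectorField_eq_nhds (h u) (h v)]
  have h0 : VectorField.lieBracketWithin ℝ (fun _ : E => u) (fun _ : E => v)
      ((extChartAt I x).symm ⁻¹' Set.univ ∩ Set.range I) (extChartAt I x x) = 0 := by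
    simp [VectorField.lieBracketWithin_eq]
  rw [h0]
  exact map_zero _

theorem fderiv_comp_extChartAt_symm {f : N → ℝ} {x : N} (hf : MDifferentiableAt I 𝓘(ℝ, ℝ) f x)
    (v : E) : fderiv ℝ (fun y => f ((extChartAt I x).symm y)) (extChartAt I x x) v =
      mvfderiv I f x (chartField I x v x) := by
  rw [chartField_self]
  simp only [mvfderiv, hf.mfderiv, I.range_eq_univ, fderivWithin_univ]
  rfl

end ChartField

section Kahler

variable {E : Type*} [NormedAddCommGroup E] [NormedSpace ℝ E]
  {H : Type*} [TopologicalSpace H] {I : ModelWithCorners ℝ E H}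
  {N : Type*} [TopologicalSpace N] [ChartedSpace H N] [IsManifold I ∞ N]
  [RiemannianBundle (fun x : N => TangentSpace I x)]

theorem OrthogonalComplexStructure.kahlerForm_apply (J : OrthogonalComplexStructure I N) (x : N)
    (v : Fin 2 → TangentSpace I x) :
    J.kahlerForm x v = inner ℝ (J.toFun x (v 0)) (v 1) := rfl

theorem OrthogonalComplexStructure.chartRep_kahlerForm (J : OrthogonalComplexStructure I N)
    (x₀ : N) {y : E} (hy : y ∈ (extChartAt I x₀).target) (v : Fin 2 → E) :
    J.kahlerForm.chartRep x₀ y v =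
      (fun z => inner ℝ (J.toFun z (chartField I x₀ (v 0) z)) (chartField I x₀ (v 1) z))
        ((extChartAt I x₀).symm y) := by
  simp only [chartField_symm x₀ _ hy]
  rfl

theorem OrthogonalComplexStructure.contMDiffAt_chartField (J : OrthogonalComplexStructure I N)
    (x₀ : N) (v : E) {z : N} (hz : z ∈ (chartAt H x₀).source) :
    ContMDiffAt I (I.prod 𝓘(ℝ, E)) ∞
      (fun z => TotalSpace.mk' E (E := fun z : N => TangentSpace I z) z
        (J.toFun z (chartField I x₀ v z))) z :=
  (J.smooth z).clm_bundle_apply (FluxVacua.contMDiffAt_chartField x₀ v hz)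

variable [IsContMDiffRiemannianBundle I ∞ E (fun x : N => TangentSpace I x)]

theorem OrthogonalComplexStructure.contMDiffAt_inner (J : OrthogonalComplexStructure I N) (x₀ : N)
    (u v : E) {z : N} (hz : z ∈ (chartAt H x₀).source) :
    ContMDiffAt I 𝓘(ℝ, ℝ) ∞
      (fun z => inner ℝ (J.toFun z (chartField I x₀ u z)) (chartField I x₀ v z)) z :=
  ContMDiffAt.inner_bundle (J.contMDiffAt_chartField x₀ u hz)
    (FluxVacua.contMDiffAt_chartField x₀ v hz)

variable [FiniteDimensional ℝ E]

theorem OrthogonalComplexStructure.isSmooth_kahlerForm (J : OrthogonalComplexStructure I N) :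
    J.kahlerForm.IsSmooth := by
  refine DForm.isSmooth_of_apply fun x₀ v => ?_
  have h : ContMDiffOn I 𝓘(ℝ, ℝ) ∞ (fun z => inner ℝ (J.toFun z (chartField I x₀ (v 0) z))
      (chartField I x₀ (v 1) z)) (chartAt H x₀).source :=
    fun z hz => (J.contMDiffAt_inner x₀ (v 0) (v 1) hz).contMDiffWithinAt
  refine ((h.comp (contMDiffOn_extChartAt_symm x₀) fun y hy => ?_).contDiffOn).congr
    fun y hy => J.chartRep_kahlerForm x₀ hy v
  rw [← extChartAt_source I]
  exact (extChartAt I x₀).map_target hy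

variable [I.Boundaryless]

theorem OrthogonalComplexStructure.isClosedForm_kahlerForm (J : OrthogonalComplexStructure I N)
    (nabla : CovariantDerivative I E (fun x : N => TangentSpace I x))
    (htor : nabla.torsion = 0)
    (hmet : CovariantDerivative.IsMetricCompatible (V := fun x : N => TangentSpace I x) nabla)
    (hJ : IsParallelEndo nabla J.toFun) : J.kahlerForm.IsClosedForm := by
  rw [DForm.IsClosedForm, DForm.d_eq_zero_iff]
  intro x
  have hx := mem_chart_source H x
  have hX : ∀ v, MDifferentiableAt I (I.prod 𝓘(ℝ, E))
      (fun z => TotalSpace.mk' E z (chartField I x v z)) x := fun v =>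
    (FluxVacua.contMDiffAt_chartField x v hx).mdifferentiableAt (by simp)
  have hsymm : ∀ u v, nabla (chartField I x v) x (chartField I x u x) =
      nabla (chartField I x u) x (chartField I x v x) := by
    intro u v
    have := (nabla.torsion_eq_zero_iff.1 htor) (hX u) (hX v)
    rwa [mlieBracket_chartField, sub_eq_zero] at this
  have hder : ∀ u p q, fderiv ℝ (fun y => J.kahlerForm.chartRep x y ![p, q]) (extChartAt I x x) u =
      inner ℝ (J.toFun x (nabla (chartField I x p) x (chartField I x u x))) (chartField I x q x) +
      inner ℝ (J.toFun x (chartField I x p x)) (nabla (chartField I x q) x (chartField I x u x)) := by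
    intro u p q
    have he : (fun y => J.kahlerForm.chartRep x y ![p, q]) =ᶠ[nhds (extChartAt I x x)]
        fun y => (fun z => inner ℝ (J.toFun z (chartField I x p z)) (chartField I x q z))
          ((extChartAt I x).symm y) := by
      filter_upwards [(isOpen_extChartAt_target x).mem_nhds (mem_extChartAt_target x)] with y hy
      exact J.chartRep_kahlerForm x hy _
    rw [he.fderiv_eq, fderiv_comp_extChartAt_symm
      ((J.contMDiffAt_inner x p q hx).mdifferentiableAt (by simp))]
    have := hmet.mvfderiv_inner_eq (x := x) (chartField I x u)
      ((J.contMDiffAt_chartField x p hx).mdifferentiableAt (by simp)) (hX q)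
    refine this.trans ?_
    have h2 := hJ x _ (hX p)
    change inner ℝ (nabla (fun y => J.toFun y (chartField I x p y)) x (chartField I x u x)) _ + _ = _
    rw [h2]
    rfl
  have hskew : ∀ u v : TangentSpace I x, inner ℝ (J.toFun x u) v = -inner ℝ (J.toFun x v) u := by
    intro u v
    have := altForm_two_swap (J.kahlerForm x) u v
    exact this
  ext v
  have e : v = ![v 0, v 1, v 2] := by ext i; fin_cases i <;> rfl
  rw [e, DForm.extDeriv_two_apply J.isSmooth_kahlerForm, hder, hder, hder, hsymm (v 1) (v 0),
    hsymm (v 2) (v 0), hsymm (v 2) (v 1),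
    hskew (nabla (chartField I x (v 2)) x (chartField I x (v 0) x))]
  simp

end Kahler

/-! ### Smooth bundle homomorphisms -/

section HomBundle

variable {E : Type*} [NormedAddCommGroup E] [NormedSpace ℝ E] [FiniteDimensional ℝ E]
  {H : Type*} [TopologicalSpace H] {I : ModelWithCorners ℝ E H}
  {M : Type*} [TopologicalSpace M] [ChartedSpace H M] [IsManifold I ∞ M]
  {F : Type*} [NormedAddCommGroup F] [NormedSpace ℝ F] [FiniteDimensional ℝ F]
  {W : M → Type*} [∀ x, AddCommGroup (W x)] [∀ x, Module ℝ (W x)]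
  [TopologicalSpace (TotalSpace F W)] [∀ x, TopologicalSpace (W x)]
  [∀ x, IsTopologicalAddGroup (W x)] [∀ x, ContinuousSMul ℝ (W x)]
  [FiberBundle F W] [VectorBundle ℝ F W]

theorem contMDiffAt_hom_of_chartField {φ : (x : M) → (TangentSpace I x →L[ℝ] W x)} {x₀ : M}
    (h : ∀ v, ContMDiffAt I (I.prod 𝓘(ℝ, F)) ∞
      (fun z => TotalSpace.mk' F z (φ z (chartField I x₀ v z))) x₀) :
    ContMDiffAt I (I.prod 𝓘(ℝ, E →L[ℝ] F)) ∞
      (fun z => TotalSpace.mk' (E →L[ℝ] F) (E := fun z : M => TangentSpace I z →L[ℝ] W z) z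
        (φ z)) x₀ := by
  rw [contMDiffAt_hom_bundle]
  refine ⟨contMDiffAt_id, ?_⟩
  rw [← contMDiffWithinAt_univ]
  refine contMDiffWithinAt_clm_of_apply fun v => ?_
  rw [contMDiffWithinAt_univ]
  refine (contMDiffAt_totalSpace.1 (h v)).2.congr_of_eventuallyEq ?_
  filter_upwards [(trivializationAt F W x₀).open_baseSet.mem_nhds
    (FiberBundle.mem_baseSet_trivializationAt' x₀)] with z hz
  simp only [ContinuousLinearMap.inCoordinates, ContinuousLinearMap.comp_apply]
  rw [Trivialization.continuousLinearMapAt_apply, Trivialization.linearMapAt_apply, if_pos hz]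
  rfl

end HomBundle

section Covector

variable {E : Type*} [NormedAddCommGroup E] [NormedSpace ℝ E]
  {H : Type*} [TopologicalSpace H] {I : ModelWithCorners ℝ E H}
  {M : Type*} [TopologicalSpace M] [ChartedSpace H M]

/-- A `1`-form as a field of covectors. -/
def DForm.covector (a : DForm I M ℝ 1) (x : M) : TangentSpace I x →L[ℝ] ℝ :=
  (ContinuousAlternatingMap.ofSubsingleton ℝ (TangentSpace I x) ℝ (0 : Fin 1)).symm (a x)

theorem DForm.covector_apply (a : DForm I M ℝ 1) (x : M) (v : TangentSpace I x) :
    a.covector x v = a x ![v] := by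
  change a x (fun _ => v) = _
  congr 1
  ext i
  fin_cases i
  rfl

theorem DForm.apply_eq_covector (a : DForm I M ℝ 1) (x : M) (v : Fin 1 → TangentSpace I x) :
    a x v = a.covector x (v 0) := by
  rw [DForm.covector_apply]
  exact apply_one_eq _ v

variable [FiniteDimensional ℝ E] [IsManifold I ∞ M] [I.Boundaryless]

theorem DForm.IsSmooth.contMDiffAt_covector {a : DForm I M ℝ 1} (ha : a.IsSmooth) (x₀ : M) :
    ContMDiffAt I (I.prod 𝓘(ℝ, E →L[ℝ] ℝ)) ∞
      (fun z => TotalSpace.mk' (E →L[ℝ] ℝ)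
        (E := fun z : M => TangentSpace I z →L[ℝ] Bundle.Trivial M ℝ z) z (a.covector z)) x₀ := by
  refine contMDiffAt_hom_of_chartField fun v => ?_
  rw [contMDiffAt_totalSpace]
  refine ⟨contMDiffAt_id, ?_⟩
  have h1 : ContMDiffAt 𝓘(ℝ, E) 𝓘(ℝ, ℝ) ∞ (fun y => a.chartRep x₀ y ![v]) (extChartAt I x₀ x₀) :=
    ((ha.contDiffOn_apply x₀ ![v]).contDiffAt
      ((isOpen_extChartAt_target x₀).mem_nhds (mem_extChartAt_target x₀))).contMDiffAt
  refine (h1.comp x₀ (contMDiffAt_extChartAt (n := ∞) (x := x₀))).congr_of_eventuallyEq ?_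
  filter_upwards [extChartAt_source_mem_nhds (I := I) x₀] with z hz
  have key : ∀ (w w' : M) (_ : w = w'), a w ![chartField I x₀ v w] =
      a w' ![chartField I x₀ v w'] := by rintro w _ rfl; rfl
  change a.covector z (chartField I x₀ v z) = a.chartRep x₀ (extChartAt I x₀ z) ![v]
  rw [DForm.covector_apply, DForm.chartRep_apply]
  refine (key _ _ ((extChartAt I x₀).left_inv hz).symm).trans ?_
  congr 1
  ext i
  fin_cases i
  exact chartField_symm x₀ v ((extChartAt I x₀).map_source hz)

theorem DForm.IsSmooth.contMDiffAt_apply {a : DForm I M ℝ 1} (ha : a.IsSmooth)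
    {E' : Type*} [NormedAddCommGroup E'] [NormedSpace ℝ E']
    {H' : Type*} [TopologicalSpace H'] {I' : ModelWithCorners ℝ E' H'}
    {M' : Type*} [TopologicalSpace M'] [ChartedSpace H' M'] {b : M' → M}
    {Y : (p : M') → TangentSpace I (b p)} {p : M'}
    (hY : ContMDiffAt I' (I.prod 𝓘(ℝ, E)) ∞ (fun q => TotalSpace.mk' E (b q) (Y q)) p) :
    ContMDiffAt I' 𝓘(ℝ, ℝ) ∞ (fun q => a.covector (b q) (Y q)) p := by
  have hb : ContMDiffAt I' I ∞ b p := (contMDiffAt_totalSpace.1 hY).1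
  have h := ContMDiffAt.clm_bundle_apply (E₂ := Bundle.Trivial M ℝ)
    ((ha.contMDiffAt_covector (b p)).comp p hb) hY
  exact (contMDiffAt_totalSpace.1 h).2

end Covector

/-! ### Vector fields on products -/

section Product

variable {E : Type*} [NormedAddCommGroup E] [NormedSpace ℝ E]
  {H : Type*} [TopologicalSpace H] {I : ModelWithCorners ℝ E H}
  {M : Type*} [TopologicalSpace M] [ChartedSpace H M] [IsManifold I ∞ M]
  {E' : Type*} [NormedAddCommGroup E'] [NormedSpace ℝ E']
  {H' : Type*} [TopologicalSpace H'] {I' : ModelWithCorners ℝ E' H'}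
  {M' : Type*} [TopologicalSpace M'] [ChartedSpace H' M'] [IsManifold I' ∞ M']

/-- The projection of the tangent space of a product to the first factor. -/
def tangentFst (I : ModelWithCorners ℝ E H) (I' : ModelWithCorners ℝ E' H') (p : M × M') :
    TangentSpace (I.prod I') p →L[ℝ] TangentSpace I p.1 := ContinuousLinearMap.fst ℝ E E'

/-- The projection of the tangent space of a product to the second factor. -/
def tangentSnd (I : ModelWithCorners ℝ E H) (I' : ModelWithCorners ℝ E' H') (p : M × M') :
    TangentSpace (I.prod I') p →L[ℝ] TangentSpace I' p.2 := ContinuousLinearMap.snd ℝ E E'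

/-- The tangent vector of a product with given components. -/
def tangentPair (I : ModelWithCorners ℝ E H) (I' : ModelWithCorners ℝ E' H') (p : M × M')
    (u : TangentSpace I p.1) (w : TangentSpace I' p.2) : TangentSpace (I.prod I') p :=
  ((u, w) : E × E')

variable {p : M × M'}

theorem contMDiffAt_tangentFst {Y : (q : M × M') → TangentSpace (I.prod I') q}
    (hY : ContMDiffAt (I.prod I') ((I.prod I').prod 𝓘(ℝ, E × E')) ∞
      (fun q => TotalSpace.mk' (E × E') q (Y q)) p) :
    ContMDiffAt (I.prod I') (I.prod 𝓘(ℝ, E)) ∞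
      (fun q => TotalSpace.mk' E q.1 (tangentFst I I' q (Y q))) p := by
  exact ((contMDiff_equivTangentBundleProd (I := I) (M := M) (I' := I') (M' := M')
    (n := ∞)).contMDiffAt.comp p hY).fst

theorem contMDiffAt_tangentSnd {Y : (q : M × M') → TangentSpace (I.prod I') q}
    (hY : ContMDiffAt (I.prod I') ((I.prod I').prod 𝓘(ℝ, E × E')) ∞
      (fun q => TotalSpace.mk' (E × E') q (Y q)) p) :
    ContMDiffAt (I.prod I') (I'.prod 𝓘(ℝ, E')) ∞
      (fun q => TotalSpace.mk' E' q.2 (tangentSnd I I' q (Y q))) p := by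
  exact ((contMDiff_equivTangentBundleProd (I := I) (M := M) (I' := I') (M' := M')
    (n := ∞)).contMDiffAt.comp p hY).snd

theorem contMDiffAt_tangentPair {u : (q : M × M') → TangentSpace I q.1}
    {w : (q : M × M') → TangentSpace I' q.2}
    (hu : ContMDiffAt (I.prod I') (I.prod 𝓘(ℝ, E)) ∞ (fun q => TotalSpace.mk' E q.1 (u q)) p)
    (hw : ContMDiffAt (I.prod I') (I'.prod 𝓘(ℝ, E')) ∞ (fun q => TotalSpace.mk' E' q.2 (w q)) p) :
    ContMDiffAt (I.prod I') ((I.prod I').prod 𝓘(ℝ, E × E')) ∞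
      (fun q => TotalSpace.mk' (E × E') q (tangentPair I I' q (u q) (w q))) p := by
  exact (contMDiff_equivTangentBundleProd_symm (I := I) (M := M) (I' := I') (M' := M')
    (n := ∞)).contMDiffAt.comp p (hu.prodMk hw)

end Product

/-! ### Anticommuting orthogonal complex structures -/

namespace OrthogonalComplexStructure

section Combination

variable {E : Type*} [NormedAddCommGroup E] [NormedSpace ℝ E]
  {H : Type*} [TopologicalSpace H] {I : ModelWithCorners ℝ E H}
  {N : Type*} [TopologicalSpace N] [ChartedSpace H N] [IsManifold I ∞ N]
  [RiemannianBundle (fun x : N => TangentSpace I x)]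

theorem inner_apply_left (P : OrthogonalComplexStructure I N) (x : N) (u v : TangentSpace I x) :
    inner ℝ (P.toFun x u) v = -inner ℝ u (P.toFun x v) := by
  rw [← P.orthogonal x u, P.sq, inner_neg_right, neg_neg]

theorem inner_anticomm {P Q : OrthogonalComplexStructure I N}
    (h : ∀ x v, P.toFun x (Q.toFun x v) = -Q.toFun x (P.toFun x v)) (x : N)
    (u v : TangentSpace I x) :
    inner ℝ (P.toFun x u) (Q.toFun x v) + inner ℝ (Q.toFun x u) (P.toFun x v) = 0 := by
  rw [P.inner_apply_left, Q.inner_apply_left, h, inner_neg_right]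
  ring

/-- The combination `c P + s Q` of anticommuting complex structures, where `c² + s² = 1`. -/
def combination (P Q : OrthogonalComplexStructure I N)
    (h : ∀ x v, P.toFun x (Q.toFun x v) = -Q.toFun x (P.toFun x v)) (c s : ℝ)
    (hcs : c ^ 2 + s ^ 2 = 1) : OrthogonalComplexStructure I N where
  toFun x := c • P.toFun x + s • Q.toFun x
  smooth := (ContMDiff.const_smul_section (a := c) P.smooth).add_section
    (ContMDiff.const_smul_section (a := s) Q.smooth)
  sq x v := by
    simp only [add_apply, smul_apply, map_add, map_smul,
      P.sq, Q.sq, h]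
    have : v = (c ^ 2 + s ^ 2) • v := by rw [hcs, one_smul]
    conv_rhs => rw [this]
    module
  orthogonal x u v := by
    simp only [add_apply, smul_apply, inner_add_left,
      inner_add_right, real_inner_smul_left, real_inner_smul_right, P.orthogonal, Q.orthogonal]
    linear_combination (c * s) * inner_anticomm h x u v + inner ℝ u v * hcs

theorem combination_apply (P Q : OrthogonalComplexStructure I N)
    (h : ∀ x v, P.toFun x (Q.toFun x v) = -Q.toFun x (P.toFun x v)) (c s : ℝ)
    (hcs : c ^ 2 + s ^ 2 = 1) (x : N) (v : TangentSpace I x) :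
    (P.combination Q h c s hcs).toFun x v = c • P.toFun x v + s • Q.toFun x v := rfl

theorem kahlerForm_combination (P Q : OrthogonalComplexStructure I N)
    (h : ∀ x v, P.toFun x (Q.toFun x v) = -Q.toFun x (P.toFun x v)) (c s : ℝ)
    (hcs : c ^ 2 + s ^ 2 = 1) :
    (P.combination Q h c s hcs).kahlerForm = c • P.kahlerForm + s • Q.kahlerForm := by
  funext x
  ext v
  rw [kahlerForm_apply, combination_apply, inner_add_left, real_inner_smul_left,
    real_inner_smul_left]
  rfl

end Combination

section Dimension

variable {E : Type*} [NormedAddCommGroup E] [NormedSpace ℝ E]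
  {H : Type*} [TopologicalSpace H] {I : ModelWithCorners ℝ E H}
  {N : Type*} [TopologicalSpace N] [ChartedSpace H N] [IsManifold I ∞ N]
  [RiemannianBundle (fun x : N => TangentSpace I x)]

/-- An orthonormal basis `u, P u, Q u, P Q u`. -/
theorem exists_adapted_basis (hE : Module.finrank ℝ E = 4) (P Q : OrthogonalComplexStructure I N)
    (h : ∀ x v, P.toFun x (Q.toFun x v) = -Q.toFun x (P.toFun x v)) (x : N) :
    ∃ e : Module.Basis (Fin 4) ℝ (TangentSpace I x), Orthonormal ℝ e ∧
      P.toFun x (e 0) = e 1 ∧ Q.toFun x (e 0) = e 2 ∧ P.toFun x (e 2) = e 3 := by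
  have hdim : Module.finrank ℝ (TangentSpace I x) = 4 := hE
  have hnt : Nontrivial (TangentSpace I x) :=
    Module.nontrivial_of_finrank_pos (R := ℝ) (by omega)
  obtain ⟨u, hu⟩ := exists_norm_eq (TangentSpace I x) zero_le_one
  have h1 : inner ℝ u (P.toFun x u) = (0 : ℝ) := by rw [real_inner_comm]; exact P.inner_self x u
  have h2 : inner ℝ u (Q.toFun x u) = (0 : ℝ) := by rw [real_inner_comm]; exact Q.inner_self x u
  have h12 : inner ℝ (P.toFun x u) (Q.toFun x u) = (0 : ℝ) := by
    have := inner_anticomm h x u u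
    rw [real_inner_comm (P.toFun x u)] at this
    linarith
  have h3 : inner ℝ u (P.toFun x (Q.toFun x u)) = (0 : ℝ) := by
    have := P.inner_apply_left x u (Q.toFun x u)
    linarith
  have h13 : inner ℝ (P.toFun x u) (P.toFun x (Q.toFun x u)) = (0 : ℝ) := by
    rw [P.orthogonal, h2]
  have h23 : inner ℝ (Q.toFun x u) (P.toFun x (Q.toFun x u)) = (0 : ℝ) := by
    rw [real_inner_comm]; exact P.inner_self x _
  have hP : ∀ w, ‖P.toFun x w‖ = ‖w‖ := fun w => by
    rw [norm_eq_sqrt_real_inner, P.orthogonal, ← norm_eq_sqrt_real_inner]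
  have hQ : ∀ w, ‖Q.toFun x w‖ = ‖w‖ := fun w => by
    rw [norm_eq_sqrt_real_inner, Q.orthogonal, ← norm_eq_sqrt_real_inner]
  have ho : Orthonormal ℝ ![u, P.toFun x u, Q.toFun x u, P.toFun x (Q.toFun x u)] := by
    rw [orthonormal_iff_ite]
    intro i j
    fin_cases i <;> fin_cases j <;>
      simp [h1, h2, h12, h3, h13, h23, hP, hQ, hu,
        real_inner_comm u, real_inner_comm (P.toFun x u), real_inner_comm (Q.toFun x u)]
  refine ⟨basisOfOrthonormalOfCardEqFinrank ho (by rw [hdim]; simp), ?_, ?_, ?_, ?_⟩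
  · rwa [coe_basisOfOrthonormalOfCardEqFinrank]
  all_goals rw [coe_basisOfOrthonormalOfCardEqFinrank]; rfl

theorem wedge_kahlerForm (hE : Module.finrank ℝ E = 4) (P Q : OrthogonalComplexStructure I N)
    (h : ∀ x v, P.toFun x (Q.toFun x v) = -Q.toFun x (P.toFun x v)) :
    P.kahlerForm ∧ᵈ P.kahlerForm = Q.kahlerForm ∧ᵈ Q.kahlerForm ∧
    P.kahlerForm ∧ᵈ Q.kahlerForm = 0 ∧ ∀ x, ∃ v, (P.kahlerForm ∧ᵈ P.kahlerForm) x v = 2 := by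
  have key : ∀ x : N, ∃ e : Module.Basis (Fin 4) ℝ (TangentSpace I x),
      (P.kahlerForm ∧ᵈ P.kahlerForm) x e = 2 ∧ (Q.kahlerForm ∧ᵈ Q.kahlerForm) x e = 2 ∧
      (P.kahlerForm ∧ᵈ Q.kahlerForm) x e = 0 := by
    intro x
    obtain ⟨e, he, e1, e2, e3⟩ := exists_adapted_basis hE P Q h x
    have ho := orthonormal_iff_ite.1 he
    have f1 : P.toFun x (e 1) = -e 0 := by rw [← e1, P.sq]
    have f3 : Q.toFun x (e 1) = -e 3 := by rw [← e3, ← e1, ← e2, h, neg_neg]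
    have f2 : Q.toFun x (e 2) = -e 0 := by rw [← e2, Q.sq]
    refine ⟨e, ?_, ?_, ?_⟩ <;> rw [DForm.wedge, wedgeAlt_two_two_apply] <;>
      simp only [kahlerForm_apply, Matrix.cons_val_zero, Matrix.cons_val_one, e1, e2, e3, f1, f2,
        f3, inner_neg_left, ho] <;> norm_num [Fin.ext_iff]
  have ext4 : ∀ (x : N) (e : Module.Basis (Fin 4) ℝ (TangentSpace I x))
      (f g : TangentSpace I x [⋀^Fin 4]→L[ℝ] ℝ), f e = g e → f = g := by
    intro x e f g hfg
    refine ContinuousAlternatingMap.toAlternatingMap_injective ?_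
    rw [f.toAlternatingMap.eq_smul_basis_det e, g.toAlternatingMap.eq_smul_basis_det e]
    congr 1
  refine ⟨funext fun x => ?_, funext fun x => ?_, fun x => ?_⟩
  · obtain ⟨e, h1, h2, h3⟩ := key x
    exact ext4 x e _ _ (h1.trans h2.symm)
  · obtain ⟨e, h1, h2, h3⟩ := key x
    exact ext4 x e _ _ h3
  · obtain ⟨e, h1, h2, h3⟩ := key x
    exact ⟨e, h1⟩

end Dimension

end OrthogonalComplexStructure

/-! ### Dual frames -/

section DualFrame

variable {E : Type*} [NormedAddCommGroup E] [NormedSpace ℝ E]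
  {H : Type*} [TopologicalSpace H] {I : ModelWithCorners ℝ E H}
  {T : Type*} [TopologicalSpace T] [ChartedSpace H T]

/-- The frame dual to the pair of `1`-forms `a`, `b` on a surface. -/
structure DualFrame (a b : DForm I T ℝ 1) where
  A : (t : T) → TangentSpace I t
  B : (t : T) → TangentSpace I t
  a_A : ∀ t, a.covector t (A t) = 1
  b_A : ∀ t, b.covector t (A t) = 0
  a_B : ∀ t, a.covector t (B t) = 0
  b_B : ∀ t, b.covector t (B t) = 1
  span : ∀ t v, a.covector t v • A t + b.covector t v • B t = v

theorem DualFrame.nonempty (hE : Module.finrank ℝ E = 2) {a b : DForm I T ℝ 1}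
    (h : ∀ t, LinearIndependent ℝ ![a t, b t]) : Nonempty (DualFrame a b) := by
  have hbij : ∀ t, Function.Bijective
      ((a.covector t).prod (b.covector t) : TangentSpace I t →ₗ[ℝ] ℝ × ℝ) := by
    intro t
    have hfd : FiniteDimensional ℝ (TangentSpace I t) :=
      Module.finite_of_finrank_pos (by
        rw [show Module.finrank ℝ (TangentSpace I t) = 2 from hE]; simp)
    have hs : Function.Surjective
        ((a.covector t).prod (b.covector t) : TangentSpace I t →ₗ[ℝ] ℝ × ℝ) := by
      rw [← LinearMap.range_eq_top]
      by_contra hne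
      obtain ⟨f, hf0, hf⟩ := Submodule.exists_le_ker_of_lt_top _ (lt_top_iff_ne_top.2 hne)
      have hpq : ∀ p q : ℝ, f (p, q) = p * f (1, 0) + q * f (0, 1) := by
        intro p q
        rw [← smul_eq_mul, ← smul_eq_mul, ← map_smul, ← map_smul, ← map_add]
        simp
      have hz : f (1, 0) • a t + f (0, 1) • b t = 0 := by
        ext v
        have hv : f (a.covector t (v 0), b.covector t (v 0)) = 0 := hf ⟨v 0, rfl⟩
        rw [hpq] at hv
        rw [ContinuousAlternatingMap.add_apply, ContinuousAlternatingMap.smul_apply,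
          ContinuousAlternatingMap.smul_apply, DForm.apply_eq_covector, DForm.apply_eq_covector,
          smul_eq_mul, smul_eq_mul]
        change _ = (0 : ℝ)
        linarith
      obtain ⟨h1, h2⟩ := LinearIndependent.pair_iff.1 (h t) _ _ hz
      refine hf0 (LinearMap.ext fun ⟨p, q⟩ => ?_)
      rw [hpq, h1, h2]
      simp
    refine ⟨?_, hs⟩
    rwa [LinearMap.injective_iff_surjective_of_finrank_eq_finrank]
    rw [show Module.finrank ℝ (TangentSpace I t) = 2 from hE]
    simp
  choose A hA using fun t => (hbij t).2 (1, 0)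
  choose B hB using fun t => (hbij t).2 (0, 1)
  have hA' : ∀ t, (a.covector t (A t), b.covector t (A t)) = ((1, 0) : ℝ × ℝ) := hA
  have hB' : ∀ t, (a.covector t (B t), b.covector t (B t)) = ((0, 1) : ℝ × ℝ) := hB
  simp only [Prod.mk.injEq] at hA' hB'
  refine ⟨⟨A, B, fun t => (hA' t).1, fun t => (hA' t).2, fun t => (hB' t).1, fun t => (hB' t).2,
    fun t v => (hbij t).1 ?_⟩⟩
  refine Prod.ext ?_ ?_
  · change a.covector t (_ + _) = a.covector t v
    rw [map_add, map_smul, map_smul, (hA' t).1, (hB' t).1]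
    simp
  · change b.covector t (_ + _) = b.covector t v
    rw [map_add, map_smul, map_smul, (hA' t).2, (hB' t).2]
    simp

variable [FiniteDimensional ℝ E] [IsManifold I ∞ T] [I.Boundaryless]

theorem contMDiffAt_of_dual {a b : DForm I T ℝ 1} (ha : a.IsSmooth) (hb : b.IsSmooth)
    {A : (t : T) → TangentSpace I t} {p q : ℝ}
    (hA : ∀ t v w, (a.covector t v * b.covector t w - a.covector t w * b.covector t v) • A t =
      (p * b.covector t w - q * a.covector t w) • v -
        (p * b.covector t v - q * a.covector t v) • w)
    {t₀ : T} (u w : TangentSpace I t₀)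
    (h : a.covector t₀ u * b.covector t₀ w - a.covector t₀ w * b.covector t₀ u ≠ 0) :
    ContMDiffAt I (I.prod 𝓘(ℝ, E)) ∞ (fun t => TotalSpace.mk' E t (A t)) t₀ := by
  have hu := contMDiffAt_chartField (I := I) t₀ u (mem_chart_source H t₀)
  have hw := contMDiffAt_chartField (I := I) t₀ w (mem_chart_source H t₀)
  have au := ha.contMDiffAt_apply (b := id) hu
  have aw := ha.contMDiffAt_apply (b := id) hw
  have bu := hb.contMDiffAt_apply (b := id) hu
  have bw := hb.contMDiffAt_apply (b := id) hw
  have hD := (au.mul bw).sub (aw.mul bu)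
  have hne : a.covector t₀ (chartField I t₀ u t₀) * b.covector t₀ (chartField I t₀ w t₀) -
      a.covector t₀ (chartField I t₀ w t₀) * b.covector t₀ (chartField I t₀ u t₀) ≠ 0 := by
    have eu : chartField I t₀ u t₀ = u := chartField_self (E := E) t₀ u
    have ew : chartField I t₀ w t₀ = w := chartField_self (E := E) t₀ w
    rwa [eu, ew]
  have hnum := ((((contMDiffAt_const (c := p)).mul bw).sub ((contMDiffAt_const (c := q)).mul aw)
    ).smul_section hu).sub_section ((((contMDiffAt_const (c := p)).mul bu).sub
      ((contMDiffAt_const (c := q)).mul au)).smul_section hw)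
  refine ((hD.inv₀ hne).smul_section hnum).congr_of_eventuallyEq ?_
  filter_upwards [hD.continuousAt.eventually_ne hne] with t ht
  congr 1
  have := hA t (chartField I t₀ u t) (chartField I t₀ w t)
  exact (eq_inv_smul_iff₀ ht).2 this

theorem DualFrame.contMDiffAt_A {a b : DForm I T ℝ 1} (ha : a.IsSmooth) (hb : b.IsSmooth)
    (D : DualFrame a b) (t : T) :
    ContMDiffAt I (I.prod 𝓘(ℝ, E)) ∞ (fun t => TotalSpace.mk' E t (D.A t)) t := by
  refine contMDiffAt_of_dual (p := 1) (q := 0) ha hb (fun s v w => ?_) (D.A t) (D.B t) ?_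
  · have hv := D.span s v
    have hw := D.span s w
    generalize a.covector s v = x at *
    generalize a.covector s w = y at *
    generalize b.covector s v = z at *
    generalize b.covector s w = r at *
    rw [← hv, ← hw]
    module
  · rw [D.a_A, D.a_B, D.b_A, D.b_B]; norm_num

theorem DualFrame.contMDiffAt_B {a b : DForm I T ℝ 1} (ha : a.IsSmooth) (hb : b.IsSmooth)
    (D : DualFrame a b) (t : T) :
    ContMDiffAt I (I.prod 𝓘(ℝ, E)) ∞ (fun t => TotalSpace.mk' E t (D.B t)) t := by
  refine contMDiffAt_of_dual (p := 0) (q := 1) ha hb (fun s v w => ?_) (D.A t) (D.B t) ?_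
  · have hv := D.span s v
    have hw := D.span s w
    generalize a.covector s v = x at *
    generalize a.covector s w = y at *
    generalize b.covector s v = z at *
    generalize b.covector s w = r at *
    rw [← hv, ← hw]
    module
  · rw [D.a_A, D.a_B, D.b_A, D.b_B]; norm_num

end DualFrame

/-! ### Complex forms -/

section ComplexForm

variable {E : Type*} [NormedAddCommGroup E] [NormedSpace ℝ E]
  {H : Type*} [TopologicalSpace H] {I : ModelWithCorners ℝ E H}
  {M : Type*} [TopologicalSpace M] [ChartedSpace H M] {k : ℕ}

/-- The complex form with given real and imaginary parts. -/
def DForm.complex (a b : DForm I M ℝ k) : DForm I M ℂ k := a.toComplex + Complex.I • b.toComplex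

theorem DForm.complex_apply (a b : DForm I M ℝ k) (x : M) (v : Fin k → TangentSpace I x) :
    a.complex b x v = a x v + Complex.I * b x v := rfl

theorem DForm.toComplex_apply (a : DForm I M ℝ k) (x : M) (v : Fin k → TangentSpace I x) :
    a.toComplex x v = a x v := rfl

theorem DForm.conj_complex_apply (a b : DForm I M ℝ k) (x : M) (v : Fin k → TangentSpace I x) :
    (a.complex b).conj x v = a x v - Complex.I * b x v := by
  change (starRingEnd ℂ) (a.complex b x v) = _
  rw [DForm.complex_apply, map_add, map_mul, Complex.conj_I, Complex.conj_ofReal,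
    Complex.conj_ofReal]
  ring

theorem DForm.re_complex (a b : DForm I M ℝ k) : (a.complex b).re = a := by
  funext x
  ext v
  change (a.complex b x v).re = _
  rw [DForm.complex_apply]
  simp

theorem DForm.im_complex (a b : DForm I M ℝ k) : (a.complex b).im = b := by
  funext x
  ext v
  change (a.complex b x v).im = _
  rw [DForm.complex_apply]
  simp

theorem DForm.IsSmooth.complex [FiniteDimensional ℝ E] {a b : DForm I M ℝ k} (ha : a.IsSmooth)
    (hb : b.IsSmooth) : (a.complex b).IsSmooth :=
  DForm.isSmooth_of_apply fun x₀ v =>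
    (Complex.ofRealCLM.contDiff.comp_contDiffOn (ha.contDiffOn_apply x₀ v)).add
      (contDiffOn_const.mul (Complex.ofRealCLM.contDiff.comp_contDiffOn (hb.contDiffOn_apply x₀ v)))

end ComplexForm

theorem isVonNBounded_of_pos {E : Type*} [NormedAddCommGroup E] [NormedSpace ℝ E]
    [FiniteDimensional ℝ E] (g : E →L[ℝ] E →L[ℝ] ℝ) (hg : ∀ v, v ≠ 0 → 0 < g v v) :
    Bornology.IsVonNBounded ℝ {v | g v v < 1} := by
  have hc : Continuous fun v => g v v := by fun_prop
  rw [NormedSpace.isVonNBounded_iff]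
  rcases subsingleton_or_nontrivial E with hE | hE
  · exact (Set.toFinite _).isBounded
  obtain ⟨w, hw, hmin⟩ := (isCompact_sphere (0 : E) 1).exists_isMinOn
    (NormedSpace.sphere_nonempty.2 zero_le_one) hc.continuousOn
  have hw0 : 0 < g w w := hg w fun h => by simp [h] at hw
  refine (Metric.isBounded_iff_subset_closedBall 0).2 ⟨√(1 / g w w), fun v hv => ?_⟩
  rw [mem_closedBall_zero_iff]
  refine Real.le_sqrt_of_sq_le ?_
  rcases eq_or_ne v 0 with rfl | hv0
  · simp [hw0.le]
  have hn : 0 < ‖v‖ := norm_pos_iff.2 hv0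
  have h1 : g w w ≤ g (‖v‖⁻¹ • v) (‖v‖⁻¹ • v) := hmin (by simp [norm_smul, hn.ne'])
  have hv' : g v v < 1 := hv
  simp only [map_smul, smul_apply, smul_eq_mul] at h1
  rw [le_div_iff₀ hw0]
  have h2 : ‖v‖ ^ 2 * (‖v‖⁻¹ * (‖v‖⁻¹ * g v v)) = g v v := by field_simp
  have := mul_le_mul_of_nonneg_left h1 (sq_nonneg ‖v‖)
  linarith

/-! ### The product `SU(2)` structure -/

section ProductStructure

variable {E : Type*} [NormedAddCommGroup E] [NormedSpace ℝ E]
  {H : Type*} [TopologicalSpace H] {I : ModelWithCorners ℝ E H}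
  {N : Type*} [TopologicalSpace N] [ChartedSpace H N]
  {E' : Type*} [NormedAddCommGroup E'] [NormedSpace ℝ E']
  {H' : Type*} [TopologicalSpace H'] {I' : ModelWithCorners ℝ E' H'}
  {T : Type*} [TopologicalSpace T] [ChartedSpace H' T]

theorem pullback_fst_apply {k : ℕ} (w : DForm I N ℝ k) (p : N × T)
    (v : Fin k → TangentSpace (I.prod I') p) :
    (w.pullback Prod.fst : DForm (I.prod I') (N × T) ℝ k) p v =
      w p.1 (fun i => tangentFst I I' p (v i)) := by
  rw [DForm.pullback, mfderiv_fst]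
  rfl

theorem pullback_snd_apply {k : ℕ} (w : DForm I' T ℝ k) (p : N × T)
    (v : Fin k → TangentSpace (I.prod I') p) :
    (w.pullback Prod.snd : DForm (I.prod I') (N × T) ℝ k) p v =
      w p.2 (fun i => tangentSnd I I' p (v i)) := by
  rw [DForm.pullback, mfderiv_snd]
  rfl

theorem pullback_snd_one_apply (a : DForm I' T ℝ 1) (p : N × T)
    (v : TangentSpace (I.prod I') p) :
    (a.pullback Prod.snd : DForm (I.prod I') (N × T) ℝ 1) p ![v] =
      a.covector p.2 (tangentSnd I I' p v) := by
  rw [pullback_snd_apply, DForm.apply_eq_covector]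
  rfl

theorem DualFrame.tangent_ext {a b : DForm I' T ℝ 1} (D : DualFrame a b) (p : N × T) {u v : TangentSpace (I.prod I') p}
    (h : tangentFst I I' p u = tangentFst I I' p v)
    (ha : a.covector p.2 (tangentSnd I I' p u) = a.covector p.2 (tangentSnd I I' p v))
    (hb : b.covector p.2 (tangentSnd I I' p u) = b.covector p.2 (tangentSnd I I' p v)) :
    u = v := by
  refine Prod.ext h ?_
  change tangentSnd I I' p u = tangentSnd I I' p v
  rw [← D.span p.2 (tangentSnd I I' p u), ha, hb, D.span]

section Defs

variable [RiemannianBundle (fun x : N => TangentSpace I x)]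
variable (I I')

/-- The inner product as a continuous bilinear form. -/
def innerForm (V : Type*) [NormedAddCommGroup V] [InnerProductSpace ℝ V] : V →L[ℝ] V →L[ℝ] ℝ :=
  innerSL ℝ

/-- The metric `g_N + a ⊗ a + b ⊗ b`. -/
def productInner (a b : DForm I' T ℝ 1) (p : N × T) :
    TangentSpace (I.prod I') p →L[ℝ] TangentSpace (I.prod I') p →L[ℝ] ℝ :=
  (ContinuousLinearMap.precomp ℝ (tangentFst I I' p)).comp
      ((innerForm (TangentSpace I p.1)).comp (tangentFst I I' p)) +
    ((a.covector p.2).comp (tangentSnd I I' p)).smulRight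
      ((a.covector p.2).comp (tangentSnd I I' p)) +
    ((b.covector p.2).comp (tangentSnd I I' p)).smulRight
      ((b.covector p.2).comp (tangentSnd I I' p))

theorem productInner_apply (a b : DForm I' T ℝ 1) (p : N × T)
    (u v : TangentSpace (I.prod I') p) :
    productInner I I' a b p u v = inner ℝ (tangentFst I I' p u) (tangentFst I I' p v) +
      a.covector p.2 (tangentSnd I I' p u) * a.covector p.2 (tangentSnd I I' p v) +
      b.covector p.2 (tangentSnd I I' p u) * b.covector p.2 (tangentSnd I I' p v) := rfl

variable {I I'} [IsManifold I ∞ N]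

/-- The almost complex structure which is `P` on the first factor and the rotation from
`A` to `B` on the second one. -/
def productEndo (P : OrthogonalComplexStructure I N) {a b : DForm I' T ℝ 1} (D : DualFrame a b)
    (p : N × T) : TangentSpace (I.prod I') p →L[ℝ] TangentSpace (I.prod I') p :=
  ContinuousLinearMap.prod (M₂ := TangentSpace I p.1) (M₃ := TangentSpace I' p.2)
    ((P.toFun p.1).comp (tangentFst I I' p))
    (((a.covector p.2).smulRight (D.B p.2) - (b.covector p.2).smulRight (D.A p.2)).comp
      (tangentSnd I I' p))

variable (P : OrthogonalComplexStructure I N) {a b : DForm I' T ℝ 1} (D : DualFrame a b)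

theorem tangentFst_productEndo (p : N × T) (v : TangentSpace (I.prod I') p) :
    tangentFst I I' p (productEndo P D p v) = P.toFun p.1 (tangentFst I I' p v) := rfl

theorem tangentSnd_productEndo (p : N × T) (v : TangentSpace (I.prod I') p) :
    tangentSnd I I' p (productEndo P D p v) =
      a.covector p.2 (tangentSnd I I' p v) • D.B p.2 -
        b.covector p.2 (tangentSnd I I' p v) • D.A p.2 := rfl

theorem a_productEndo (p : N × T) (v : TangentSpace (I.prod I') p) :
    a.covector p.2 (tangentSnd I I' p (productEndo P D p v)) =
      -b.covector p.2 (tangentSnd I I' p v) := by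
  rw [tangentSnd_productEndo, map_sub, map_smul, map_smul, D.a_A, D.a_B]
  simp

theorem b_productEndo (p : N × T) (v : TangentSpace (I.prod I') p) :
    b.covector p.2 (tangentSnd I I' p (productEndo P D p v)) =
      a.covector p.2 (tangentSnd I I' p v) := by
  rw [tangentSnd_productEndo, map_sub, map_smul, map_smul, D.b_A, D.b_B]
  simp

end Defs

section Smooth

variable [IsManifold I ∞ N] [RiemannianBundle (fun x : N => TangentSpace I x)]
  [FiniteDimensional ℝ E] [FiniteDimensional ℝ E'] [IsManifold I' ∞ T] [I'.Boundaryless]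

theorem DualFrame.contMDiff_rotation {a b : DForm I' T ℝ 1} (ha : a.IsSmooth) (hb : b.IsSmooth)
    (D : DualFrame a b) :
    ContMDiff I' (I'.prod 𝓘(ℝ, E' →L[ℝ] E')) ∞
      (fun t => TotalSpace.mk' (E' →L[ℝ] E')
        (E := fun t : T => TangentSpace I' t →L[ℝ] TangentSpace I' t) t
        ((a.covector t).smulRight (D.B t) - (b.covector t).smulRight (D.A t))) := by
  intro t
  refine contMDiffAt_hom_of_chartField fun v => ?_
  have hY := contMDiffAt_chartField (I := I') t v (mem_chart_source _ t)
  exact ((ha.contMDiffAt_apply (b := id) hY).smul_section (D.contMDiffAt_B ha hb t)).sub_section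
    ((hb.contMDiffAt_apply (b := id) hY).smul_section (D.contMDiffAt_A ha hb t))

theorem contMDiff_productEndo (P : OrthogonalComplexStructure I N) {a b : DForm I' T ℝ 1}
    (ha : a.IsSmooth) (hb : b.IsSmooth) (D : DualFrame a b) :
    ContMDiff (I.prod I') ((I.prod I').prod 𝓘(ℝ, E × E' →L[ℝ] E × E')) ∞
      (fun p => TotalSpace.mk' (E × E' →L[ℝ] E × E')
        (E := fun p : N × T => TangentSpace (I.prod I') p →L[ℝ] TangentSpace (I.prod I') p) p
        (productEndo P D p)) := by
  intro p
  refine contMDiffAt_hom_of_chartField fun v => ?_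
  have hY := contMDiffAt_chartField (I := I.prod I') p v (mem_chart_source _ p)
  have hP : ContMDiffAt (I.prod I') (I.prod 𝓘(ℝ, E →L[ℝ] E)) ∞
      (fun q : N × T => TotalSpace.mk' (E →L[ℝ] E)
        (E := fun x : N => TangentSpace I x →L[ℝ] TangentSpace I x) q.1 (P.toFun q.1)) p :=
    (P.smooth p.1).comp p contMDiffAt_fst
  have hR : ContMDiffAt (I.prod I') (I'.prod 𝓘(ℝ, E' →L[ℝ] E')) ∞
      (fun q : N × T => TotalSpace.mk' (E' →L[ℝ] E')
        (E := fun t : T => TangentSpace I' t →L[ℝ] TangentSpace I' t) q.2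
        ((a.covector q.2).smulRight (D.B q.2) - (b.covector q.2).smulRight (D.A q.2))) p :=
    (D.contMDiff_rotation ha hb p.2).comp p contMDiffAt_snd
  exact contMDiffAt_tangentPair (hP.clm_bundle_apply (contMDiffAt_tangentFst hY))
    (hR.clm_bundle_apply (contMDiffAt_tangentSnd hY))

variable [IsContMDiffRiemannianBundle I ∞ E (fun x : N => TangentSpace I x)]

theorem contMDiff_productInner {a b : DForm I' T ℝ 1} (ha : a.IsSmooth) (hb : b.IsSmooth) :
    ContMDiff (I.prod I') ((I.prod I').prod 𝓘(ℝ, E × E' →L[ℝ] E × E' →L[ℝ] ℝ)) ∞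
      (fun p => TotalSpace.mk' (E × E' →L[ℝ] E × E' →L[ℝ] ℝ)
        (E := fun p : N × T => TangentSpace (I.prod I') p →L[ℝ] TangentSpace (I.prod I') p →L[ℝ] ℝ)
        p (productInner I I' a b p)) := by
  intro p
  refine contMDiffAt_hom_of_chartField (F := E × E' →L[ℝ] ℝ)
    (W := fun p : N × T => TangentSpace (I.prod I') p →L[ℝ] Bundle.Trivial (N × T) ℝ p) fun u => ?_
  refine contMDiffAt_hom_of_chartField (F := ℝ) (W := Bundle.Trivial (N × T) ℝ) fun v => ?_
  rw [contMDiffAt_totalSpace]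
  refine ⟨contMDiffAt_id, ?_⟩
  have hu := contMDiffAt_chartField (I := I.prod I') p u (mem_chart_source _ p)
  have hv := contMDiffAt_chartField (I := I.prod I') p v (mem_chart_source _ p)
  have hu2 := contMDiffAt_tangentSnd hu
  have hv2 := contMDiffAt_tangentSnd hv
  have hi : ContMDiffAt (I.prod I') 𝓘(ℝ, ℝ) ∞ (fun q : N × T =>
      inner ℝ (tangentFst I I' q (chartField (I.prod I') p u q))
        (tangentFst I I' q (chartField (I.prod I') p v q))) p :=
    ContMDiffAt.inner_bundle (contMDiffAt_tangentFst hu) (contMDiffAt_tangentFst hv)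
  exact (hi.add
    ((ha.contMDiffAt_apply hu2).mul (ha.contMDiffAt_apply hv2))).add
    ((hb.contMDiffAt_apply hu2).mul (hb.contMDiffAt_apply hv2))

end Smooth

end ProductStructure

/-! ### Wedge products of complex 2-forms -/

section ComplexWedge

variable {E : Type*} [NormedAddCommGroup E] [NormedSpace ℝ E]
  {H : Type*} [TopologicalSpace H] {I : ModelWithCorners ℝ E H}
  {M : Type*} [TopologicalSpace M] [ChartedSpace H M]

theorem DForm.wedge_pullback {E' : Type*} [NormedAddCommGroup E'] [NormedSpace ℝ E']
    {H' : Type*} [TopologicalSpace H'] {I' : ModelWithCorners ℝ E' H'}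
    {M' : Type*} [TopologicalSpace M'] [ChartedSpace H' M'] (φ : M → M') {k l : ℕ}
    (f : DForm I' M' ℝ k) (g : DForm I' M' ℝ l) :
    (f.pullback φ : DForm I M ℝ k) ∧ᵈ (g.pullback φ : DForm I M ℝ l) = (f ∧ᵈ g).pullback φ :=
  funext fun _ => wedgeAlt_compContinuousLinearMap _ _ _

theorem DForm.two_wedge_complex_apply (e f g : DForm I M ℝ 2) (x : M)
    (v : Fin 4 → TangentSpace I x) :
    (e.toComplex ∧ᵈ f.complex g) x v = (e ∧ᵈ f) x v + Complex.I * (e ∧ᵈ g) x v := by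
  simp only [DForm.wedge, wedgeAlt_two_two_apply, DForm.complex_apply, DForm.toComplex_apply]
  push_cast
  ring

theorem DForm.complex_wedge_self_apply (f g : DForm I M ℝ 2) (x : M)
    (v : Fin 4 → TangentSpace I x) :
    (f.complex g ∧ᵈ f.complex g) x v =
      (f ∧ᵈ f) x v - (g ∧ᵈ g) x v + 2 * Complex.I * (f ∧ᵈ g) x v := by
  simp only [DForm.wedge, wedgeAlt_two_two_apply, DForm.complex_apply]
  push_cast
  ring_nf
  rw [Complex.I_sq]
  ring

theorem DForm.complex_wedge_conj_apply (f g : DForm I M ℝ 2) (x : M)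
    (v : Fin 4 → TangentSpace I x) :
    (f.complex g ∧ᵈ (f.complex g).conj) x v = (f ∧ᵈ f) x v + (g ∧ᵈ g) x v := by
  simp only [DForm.wedge, wedgeAlt_two_two_apply, DForm.complex_apply, DForm.conj_complex_apply]
  push_cast
  ring_nf
  rw [Complex.I_sq]
  ring

theorem DForm.complex_wedge_conj_one_apply (f g : DForm I M ℝ 1) (x : M)
    (u v : TangentSpace I x) :
    (f.complex g ∧ᵈ (f.complex g).conj) x ![u, v] =
      2 * Complex.I * (g x ![u] * f x ![v] - f x ![u] * g x ![v]) := by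
  simp only [DForm.wedge, wedgeAlt_one_one_apply, DForm.complex_apply, DForm.conj_complex_apply,
    Matrix.cons_val_zero, Matrix.cons_val_one]
  ring

end ComplexWedge

/-! ### The `SU(2)` structure -/

section ProductSU2

variable {E : Type*} [NormedAddCommGroup E] [NormedSpace ℝ E]
  {H : Type*} [TopologicalSpace H] {I : ModelWithCorners ℝ E H}
  {N : Type*} [TopologicalSpace N] [ChartedSpace H N]
  [RiemannianBundle (fun x : N => TangentSpace I x)]
  {E' : Type*} [NormedAddCommGroup E'] [NormedSpace ℝ E']
  {H' : Type*} [TopologicalSpace H'] {I' : ModelWithCorners ℝ E' H'}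
  {T : Type*} [TopologicalSpace T] [ChartedSpace H' T]

theorem DualFrame.productInner_pos {a b : DForm I' T ℝ 1} (D : DualFrame a b) (p : N × T)
    (v : TangentSpace (I.prod I') p) (hv : v ≠ 0) : 0 < productInner I I' a b p v v := by
  rw [productInner_apply]
  have h1 : (0 : ℝ) ≤ inner ℝ (tangentFst I I' p v) (tangentFst I I' p v) :=
    real_inner_self_nonneg
  have h2 := mul_self_nonneg (a.covector p.2 (tangentSnd I I' p v))
  have h3 := mul_self_nonneg (b.covector p.2 (tangentSnd I I' p v))
  refine lt_of_le_of_ne (by positivity) fun h => hv ?_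
  have e1 : tangentFst I I' p v = 0 := inner_self_eq_zero (𝕜 := ℝ).1 (by linarith)
  refine D.tangent_ext p (e1.trans (map_zero _).symm) ?_ ?_
  · rw [mul_self_eq_zero.1 (by linarith : a.covector p.2 (tangentSnd I I' p v) *
      a.covector p.2 (tangentSnd I I' p v) = 0), map_zero, map_zero]
  · rw [mul_self_eq_zero.1 (by linarith : b.covector p.2 (tangentSnd I I' p v) *
      b.covector p.2 (tangentSnd I I' p v) = 0), map_zero, map_zero]

theorem tangentFst_eq_zero_of_dual {a b : DForm I' T ℝ 1} {p : N × T}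
    {w : TangentSpace (I.prod I') p} {c : DForm I' T ℝ 1}
    (hw : ∀ v, productInner I I' a b p w v = c.covector p.2 (tangentSnd I I' p v)) :
    tangentFst I I' p w = 0 := by
  have h := hw (tangentPair I I' p (tangentFst I I' p w) 0)
  have h1 : tangentFst I I' p (tangentPair I I' p (tangentFst I I' p w) 0) =
    tangentFst I I' p w := rfl
  have h2 : tangentSnd I I' p (tangentPair I I' p (tangentFst I I' p w) 0) = 0 := rfl
  rw [productInner_apply, h1, h2, map_zero, map_zero, map_zero, mul_zero, mul_zero, add_zero,
    add_zero] at h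
  exact inner_self_eq_zero (𝕜 := ℝ).1 h

theorem productInner_tangentPair (a b : DForm I' T ℝ 1) (p : N × T)
    (w : TangentSpace (I.prod I') p) (v : TangentSpace I' p.2) :
    productInner I I' a b p w (tangentPair I I' p 0 v) =
      a.covector p.2 (tangentSnd I I' p w) * a.covector p.2 v +
        b.covector p.2 (tangentSnd I I' p w) * b.covector p.2 v := by
  have h1 : tangentFst I I' p (tangentPair I I' p 0 v) = 0 := rfl
  have h2 : tangentSnd I I' p (tangentPair I I' p 0 v) = v := rfl
  rw [productInner_apply, h1, h2, inner_zero_right, zero_add]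

theorem DualFrame.a_of_dual {a b c : DForm I' T ℝ 1} (D : DualFrame a b) {p : N × T}
    {w : TangentSpace (I.prod I') p}
    (hw : ∀ v, productInner I I' a b p w v = c.covector p.2 (tangentSnd I I' p v)) :
    a.covector p.2 (tangentSnd I I' p w) = c.covector p.2 (D.A p.2) := by
  have h := hw (tangentPair I I' p 0 (D.A p.2))
  rw [productInner_tangentPair, D.a_A, D.b_A, mul_one, mul_zero, add_zero] at h
  exact h

theorem DualFrame.b_of_dual {a b c : DForm I' T ℝ 1} (D : DualFrame a b) {p : N × T}
    {w : TangentSpace (I.prod I') p}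
    (hw : ∀ v, productInner I I' a b p w v = c.covector p.2 (tangentSnd I I' p v)) :
    b.covector p.2 (tangentSnd I I' p w) = c.covector p.2 (D.B p.2) := by
  have h := hw (tangentPair I I' p 0 (D.B p.2))
  rw [productInner_tangentPair, D.a_B, D.b_B, mul_one, mul_zero, zero_add] at h
  exact h

variable [IsManifold I ∞ N]

theorem anticomm_of_quaternion {P Q R : OrthogonalComplexStructure I N}
    (hPQ : ∀ x v, P.toFun x (Q.toFun x v) = R.toFun x v)
    (hQP : ∀ x v, Q.toFun x (P.toFun x v) = -R.toFun x v) :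
    (∀ x v, P.toFun x (R.toFun x v) = -R.toFun x (P.toFun x v)) ∧
      ∀ x v, Q.toFun x (R.toFun x v) = -R.toFun x (Q.toFun x v) := by
  refine ⟨fun x v => ?_, fun x v => ?_⟩
  · rw [← hPQ x (P.toFun x v), hQP, map_neg, neg_neg]
  · rw [← hPQ x v, hQP]

theorem inner_productEndo (P : OrthogonalComplexStructure I N) {a b : DForm I' T ℝ 1}
    (D : DualFrame a b) (p : N × T) (u v : TangentSpace (I.prod I') p) :
    productInner I I' a b p (productEndo P D p u) v =
      inner ℝ (P.toFun p.1 (tangentFst I I' p u)) (tangentFst I I' p v) +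
      (a.covector p.2 (tangentSnd I I' p u) * b.covector p.2 (tangentSnd I I' p v) -
      b.covector p.2 (tangentSnd I I' p u) * a.covector p.2 (tangentSnd I I' p v)) := by
  rw [productInner_apply, a_productEndo, b_productEndo, tangentFst_productEndo]
  ring

theorem pullback_kahlerForm_apply (P : OrthogonalComplexStructure I N) (p : N × T)
    (u v : TangentSpace (I.prod I') p) :
    (P.kahlerForm.pullback Prod.fst : DForm (I.prod I') (N × T) ℝ 2) p ![u, v] =
      inner ℝ (P.toFun p.1 (tangentFst I I' p u)) (tangentFst I I' p v) := by
  rw [pullback_fst_apply]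
  rfl

theorem fundamental_productInner (P : OrthogonalComplexStructure I N) {a b : DForm I' T ℝ 1}
    (D : DualFrame a b) (p : N × T) (u v : TangentSpace (I.prod I') p) :
    ((productInner I I' a b p (productEndo P D p u) v : ℝ) : ℂ) =
      ((P.kahlerForm.pullback Prod.fst : DForm (I.prod I') (N × T) ℝ 2).toComplex +
        (Complex.I / 2) • ((DForm.complex (a.pullback Prod.snd) (b.pullback Prod.snd) :
          DForm (I.prod I') (N × T) ℂ 1) ∧ᵈ
          (DForm.complex (a.pullback Prod.snd) (b.pullback Prod.snd)).conj)) p ![u, v] := by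
  rw [Pi.add_apply, Pi.smul_apply, ContinuousAlternatingMap.add_apply,
    ContinuousAlternatingMap.smul_apply, DForm.complex_wedge_conj_one_apply, inner_productEndo,
    DForm.toComplex_apply, pullback_kahlerForm_apply,
    pullback_snd_one_apply, pullback_snd_one_apply, pullback_snd_one_apply,
    pullback_snd_one_apply, smul_eq_mul]
  push_cast
  linear_combination ((a.covector p.2 (tangentSnd I I' p u) : ℂ) *
    b.covector p.2 (tangentSnd I I' p v) - b.covector p.2 (tangentSnd I I' p u) *
    a.covector p.2 (tangentSnd I I' p v)) * Complex.I_sq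

variable [FiniteDimensional ℝ E] [FiniteDimensional ℝ E'] [IsManifold I' ∞ T]
  [I.Boundaryless] [I'.Boundaryless]
  [IsContMDiffRiemannianBundle I ∞ E (fun x : N => TangentSpace I x)]

/-- The metric `g_N + a ⊗ a + b ⊗ b` on `N × T`. -/
def DualFrame.productMetric {a b : DForm I' T ℝ 1} (ha : a.IsSmooth) (hb : b.IsSmooth)
    (D : DualFrame a b) :
    ContMDiffRiemannianMetric (I.prod I') ∞ (E × E')
      (fun p : N × T => TangentSpace (I.prod I') p) where
  inner := productInner I I' a b
  symm p u v := by
    rw [productInner_apply, productInner_apply, real_inner_comm]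
    ring
  pos p v hv := D.productInner_pos p v hv
  isVonNBounded p := isVonNBounded_of_pos (E := E × E') (productInner I I' a b p)
    (D.productInner_pos p)
  contMDiff := contMDiff_productInner ha hb

/-- The `SU(2)` structure on `N × T` given by orthogonal complex structures `P`, `Q`, `R` on `N`
with the quaternion relations and by a coframe `a`, `b` on `T`. -/
def productSU2 (hE : Module.finrank ℝ E = 4) (hE' : Module.finrank ℝ E' = 2)
    (P Q R : OrthogonalComplexStructure I N)
    (hPQ : ∀ x v, P.toFun x (Q.toFun x v) = R.toFun x v)
    (hQP : ∀ x v, Q.toFun x (P.toFun x v) = -R.toFun x v)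
    {a b : DForm I' T ℝ 1} (ha : a.IsSmooth) (hb : b.IsSmooth) (D : DualFrame a b) :
    SU2Structure (I.prod I') (N × T) where
  dim_eq := by rw [Module.finrank_prod, hE, hE']
  g := D.productMetric ha hb
  J := productEndo P D
  alpha := (a.pullback Prod.snd).complex (b.pullback Prod.snd)
  omega := P.kahlerForm.pullback Prod.fst
  Omega := (Q.kahlerForm.pullback Prod.fst).complex (R.kahlerForm.pullback Prod.fst)
  smooth_J := contMDiff_productEndo P ha hb D
  smooth_alpha := (ha.pullback isLinearInCharts_snd).complex (hb.pullback isLinearInCharts_snd)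
  smooth_omega := P.isSmooth_kahlerForm.pullback isLinearInCharts_fst
  smooth_Omega := (Q.isSmooth_kahlerForm.pullback isLinearInCharts_fst).complex
    (R.isSmooth_kahlerForm.pullback isLinearInCharts_fst)
  J_sq p v := by
    refine D.tangent_ext p ?_ ?_ ?_
    · rw [tangentFst_productEndo, tangentFst_productEndo, P.sq, map_neg]
    · rw [a_productEndo, b_productEndo, map_neg, map_neg]
    · rw [b_productEndo, a_productEndo, map_neg, map_neg]
  J_orthogonal p u v := by
    change productInner I I' a b p _ _ = productInner I I' a b p _ _
    rw [inner_productEndo, a_productEndo, b_productEndo, tangentFst_productEndo, P.orthogonal,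
      productInner_apply]
    ring
  alpha_type p v := by
    rw [DForm.complex_apply, DForm.complex_apply, pullback_snd_one_apply, pullback_snd_one_apply,
      pullback_snd_one_apply, pullback_snd_one_apply, a_productEndo, b_productEndo]
    push_cast
    linear_combination (-(b.covector p.2 (tangentSnd I I' p v) : ℂ)) * Complex.I_sq
  Omega_type p u v := by
    have hRP : ∀ x v, R.toFun x (P.toFun x v) = Q.toFun x v := fun x v => by
      rw [← hPQ, hQP, ← hPQ, map_neg, P.sq, neg_neg]
    rw [DForm.complex_apply, DForm.complex_apply, pullback_kahlerForm_apply,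
      pullback_kahlerForm_apply, pullback_kahlerForm_apply, pullback_kahlerForm_apply,
      tangentFst_productEndo, hQP, hRP, inner_neg_left]
    push_cast
    linear_combination
      (-(inner ℝ (R.toFun p.1 (tangentFst I I' p u)) (tangentFst I I' p v) : ℝ) : ℂ) * Complex.I_sq
  omega_sq := by
    funext p
    ext v
    change (((P.kahlerForm.pullback Prod.fst ∧ᵈ P.kahlerForm.pullback Prod.fst :
      DForm (I.prod I') (N × T) ℝ 4) p v : ℝ) : ℂ) = (1 / 2 : ℂ) * DForm.wedge _ _ p v
    rw [DForm.complex_wedge_conj_apply, DForm.wedge_pullback, DForm.wedge_pullback,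
      DForm.wedge_pullback, ← (P.wedge_kahlerForm hE Q fun x v => by rw [hPQ, hQP, neg_neg]).1,
      ← (P.wedge_kahlerForm hE R (anticomm_of_quaternion hPQ hQP).1).1]
    ring
  omega_sq_ne p h := by
    obtain ⟨v, hv⟩ := (P.wedge_kahlerForm hE Q fun x v => by rw [hPQ, hQP, neg_neg]).2.2 p.1
    rw [DForm.wedge_pullback] at h
    have h' := congr_arg (fun f => f fun i => tangentPair I I' p (v i) 0) h
    change ((P.kahlerForm ∧ᵈ P.kahlerForm).pullback Prod.fst : DForm (I.prod I') (N × T) ℝ 4) p _ =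
      0 at h'
    rw [pullback_fst_apply] at h'
    exact two_ne_zero (hv.symm.trans h')
  omega_wedge_Omega := by
    funext p
    ext v
    rw [DForm.two_wedge_complex_apply, DForm.wedge_pullback, DForm.wedge_pullback,
      (P.wedge_kahlerForm hE Q fun x v => by rw [hPQ, hQP, neg_neg]).2.1,
      (P.wedge_kahlerForm hE R (anticomm_of_quaternion hPQ hQP).1).2.1]
    change ((0 : ℝ) : ℂ) + Complex.I * ((0 : ℝ) : ℂ) = 0
    simp
  Omega_wedge_Omega := by
    funext p
    ext v
    rw [DForm.complex_wedge_self_apply, DForm.wedge_pullback, DForm.wedge_pullback,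
      DForm.wedge_pullback, (Q.wedge_kahlerForm hE R (anticomm_of_quaternion hPQ hQP).2).2.1,
      (Q.wedge_kahlerForm hE R (anticomm_of_quaternion hPQ hQP).2).1, sub_self, zero_add]
    change 2 * Complex.I * ((0 : ℝ) : ℂ) = 0
    simp
  contraction p w hw v := by
    simp only [DForm.re_complex, DForm.im_complex, pullback_snd_one_apply] at hw
    have h0 : tangentFst I I' p w = 0 := hw.elim
      (tangentFst_eq_zero_of_dual (a := a) (b := b)) (tangentFst_eq_zero_of_dual (a := a) (b := b))
    refine ⟨?_, ?_⟩
    · rw [pullback_kahlerForm_apply, h0, map_zero, inner_zero_left]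
    · rw [DForm.complex_apply, pullback_kahlerForm_apply, pullback_kahlerForm_apply, h0, map_zero,
        map_zero, inner_zero_left]
      simp
  norm_alpha p u w hu hw := by
    simp only [DForm.re_complex, DForm.im_complex, pullback_snd_one_apply] at hu hw
    rw [DForm.complex_apply, DForm.complex_apply, pullback_snd_one_apply, pullback_snd_one_apply,
      pullback_snd_one_apply, pullback_snd_one_apply, D.a_of_dual hu, D.b_of_dual hu,
      D.a_of_dual hw, D.b_of_dual hw, D.a_A, D.a_B, D.b_A, D.b_B]
    push_cast
    linear_combination -Complex.I_sq
  fundamental := fundamental_productInner P D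

end ProductSU2

section ZeroForms

variable {E : Type*} [NormedAddCommGroup E] [NormedSpace ℝ E]
  {H : Type*} [TopologicalSpace H] {I : ModelWithCorners ℝ E H}
  {M : Type*} [TopologicalSpace M] [ChartedSpace H M] {k l : ℕ}
  {A : Type*} [NormedCommRing A] [NormedAlgebra ℝ A]

theorem DForm.wedge_apply (α : DForm I M A k) (β : DForm I M A l) (x : M) :
    (α ∧ᵈ β) x = wedgeAlt (α x) (β x) := rfl

theorem DForm.zero_wedge (α : DForm I M A l) : (0 : DForm I M A k) ∧ᵈ α = 0 :=
  funext fun _ => wedgeAlt_zero_left _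

theorem DForm.wedge_zero (α : DForm I M A k) : α ∧ᵈ (0 : DForm I M A l) = 0 :=
  funext fun _ => wedgeAlt_zero_right _

theorem DForm.smul_zero (c : ℝ) : c • (0 : DForm I M A k) = 0 :=
  funext fun x => _root_.smul_zero (A := TangentSpace I x [⋀^Fin k]→L[ℝ] A) c

theorem DForm.eq_zero_of_smul {c : ℝ} (hc : c ≠ 0) {α : DForm I M A k} (h : c • α = 0) :
    α = 0 := by
  have := congr_arg (fun f => c⁻¹ • f) h
  simp only [DForm.smul_zero] at this
  rw [← this]
  funext x
  exact (inv_smul_smul₀ hc (α x)).symm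

theorem DForm.toComplex_zero : (0 : DForm I M ℝ k).toComplex = 0 := by
  funext x
  ext v
  exact Complex.ofReal_zero

theorem DForm.smul_toComplex_eq_zero_iff {c : ℂ} (hc : c ≠ 0) {α : DForm I M ℝ k} :
    c • α.toComplex = 0 ↔ α = 0 := by
  constructor
  · intro h
    funext x
    ext v
    have hv : c * (α x v : ℂ) = 0 := congr_arg (fun f : DForm I M ℂ k => f x v) h
    exact Complex.ofReal_eq_zero.1 ((mul_eq_zero.1 hv).resolve_left hc)
  · rintro rfl
    funext x
    ext v
    change c * ((0 : ℝ) : ℂ) = 0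
    simp

end ZeroForms

namespace SU2Structure

variable {E : Type*} [NormedAddCommGroup E] [NormedSpace ℝ E]
  {H : Type*} [TopologicalSpace H] {I : ModelWithCorners ℝ E H}
  {M : Type*} [TopologicalSpace M] [ChartedSpace H M] [IsManifold I ∞ M]
  (S : SU2Structure I M)

theorem fundamentalForm_apply (x : M) (u v : TangentSpace I x) :
    S.fundamentalForm x ![u, v] = S.g.inner x (S.J x u) v := by
  rw [← Complex.ofReal_re (S.g.inner x (S.J x u) v), S.fundamental]
  rfl

/-- The frame `e` is a unitary frame at `x`: it is orthonormal and `J` is standard in it. -/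
structure IsUnitaryFrame (x : M) (e : Module.Basis (Fin 6) ℝ (TangentSpace I x)) : Prop where
  orthonormal : ∀ i j, S.g.inner x (e i) (e j) = if i = j then 1 else 0
  symplectic : ∀ i j, S.g.inner x (S.J x (e i)) (e j) = stdSymplectic i j

variable {S}

theorem IsUnitaryFrame.vol_eq_one {x : M} {e : Module.Basis (Fin 6) ℝ (TangentSpace I x)}
    (h : S.IsUnitaryFrame x e) : S.vol x e = 1 := by
  have h6 := wedgeAlt_cube_apply (S.fundamentalForm x) e fun i j => by
    rw [fundamentalForm_apply, h.symplectic]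
  rw [vol, Pi.smul_apply, ContinuousAlternatingMap.smul_apply, DForm.wedge_apply,
    DForm.wedge_apply]
  erw [h6]
  norm_num

theorem isHodgeStar_zero {k l : ℕ} (hkl : k + l = 6) :
    S.IsHodgeStar hkl (0 : DForm I M ℝ k) (0 : DForm I M ℝ l) := by
  intro x e _ η v
  simp

theorem eq_zero_of_isHodgeStar_zero (hS : ∀ x, ∃ e, S.IsUnitaryFrame x e) {k l : ℕ}
    {hkl : k + l = 6} {β : DForm I M ℝ k} (h : S.IsHodgeStar hkl β (0 : DForm I M ℝ l)) :
    β = 0 := by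
  funext x
  obtain ⟨e, he⟩ := hS x
  have h0 := h x e he.orthonormal (β x) e
  rw [he.vol_eq_one, mul_one, Pi.zero_apply, wedgeAlt_zero_right] at h0
  have hsum : ∑ i : Fin k → Fin 6, β x (e ∘ i) * β x (e ∘ i) = 0 :=
    (mul_eq_zero.1 h0.symm).resolve_left (by positivity)
  rw [Finset.sum_eq_zero_iff_of_nonneg fun i _ => mul_self_nonneg _] at hsum
  refine ContinuousAlternatingMap.toAlternatingMap_injective ?_
  exact Module.Basis.ext_alternating e fun i _ => mul_self_eq_zero.1 (hsum i (Finset.mem_univ i))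

theorem solvesIIA_iff (hS : ∀ x, ∃ e, S.IsUnitaryFrame x e) {kpar gs : ℝ} (hk : kpar ≠ 0)
    (hgs : gs ≠ 0) (hre : S.alpha.re.IsClosedForm) (him : S.alpha.im.IsClosedForm)
    (hΩ : S.Omega.im.IsClosedForm) (hpar : (S.reOmegaPar (angleIIA kpar)).IsClosedForm)
    (hperp : (S.reOmegaPerp (angleIIA kpar)).IsClosedForm)
    (hwedge : (S.alpha.im ∧ᵈ S.reOmegaPar (angleIIA kpar)).IsClosedForm)
    (Hf : DForm I M ℝ 3) (F0 : DForm I M ℝ 0) (F2 : DForm I M ℝ 2) (F4 : DForm I M ℝ 4) :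
    SolvesIIA S kpar gs Hf F0 F2 F4 ↔ Hf = 0 ∧ F0 = 0 ∧ F2 = 0 ∧ F4 = 0 := by
  rw [DForm.IsClosedForm] at hre him hΩ hpar hperp hwedge
  constructor
  · intro h
    have hH : Hf = 0 := by
      have := h.flux_H
      rw [hΩ, DForm.smul_zero] at this
      exact DForm.eq_zero_of_smul hk this
    subst hH
    refine ⟨rfl, ?_, ?_, ?_⟩
    · obtain ⟨G, hG, e⟩ := h.flux_F0
      simp only [him, DForm.zero_wedge, DForm.smul_zero, add_zero] at e
      rw [DForm.eq_zero_of_smul hgs e] at hG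
      exact eq_zero_of_isHodgeStar_zero hS hG
    · obtain ⟨G, hG, e⟩ := h.flux_F2
      rw [hpar, him, DForm.zero_wedge, DForm.zero_wedge, DForm.smul_zero,
        DForm.smul_zero, add_zero] at e
      rw [DForm.eq_zero_of_smul hgs e] at hG
      exact eq_zero_of_isHodgeStar_zero hS hG
    · obtain ⟨G, hG, e⟩ := h.flux_F4
      rw [him, DForm.smul_zero] at e
      rw [DForm.eq_zero_of_smul hgs e] at hG
      exact eq_zero_of_isHodgeStar_zero hS hG
  · rintro ⟨rfl, rfl, rfl, rfl⟩
    refine ⟨hre, ?_, ?_, ?_, ⟨0, isHodgeStar_zero _, ?_⟩, ⟨0, isHodgeStar_zero _, ?_⟩,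
      ⟨0, isHodgeStar_zero _, ?_⟩⟩
    · rw [hΩ, DForm.smul_zero, DForm.smul_zero]
    · rw [hperp, him, DForm.wedge_zero, DForm.smul_zero]
    · rw [hwedge, DForm.zero_wedge, DForm.smul_zero]
    · rw [him, DForm.zero_wedge S.alpha.re, DForm.zero_wedge (S.reOmegaPar _),
        DForm.zero_wedge (S.Omega.im ∧ᵈ S.Omega.im), DForm.smul_zero, DForm.smul_zero,
        DForm.smul_zero, add_zero]
    · rw [hpar, him, DForm.zero_wedge, DForm.zero_wedge, DForm.smul_zero,
        DForm.smul_zero, DForm.smul_zero, add_zero]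
    · rw [him, DForm.smul_zero, DForm.smul_zero]

theorem solvesIIB_iff (hS : ∀ x, ∃ e, S.IsUnitaryFrame x e) {kpar gs : ℝ} (hk : kpar ≠ 0)
    (hkp : kPerp kpar ≠ 0)
    (hgs : gs ≠ 0) (hre : S.alpha.re.IsClosedForm) (him : S.alpha.im.IsClosedForm)
    (hΩ : S.Omega.im.IsClosedForm) (hpar : (S.reOmegaPar (angleIIB kpar)).IsClosedForm)
    (hperp : (S.reOmegaPerp (angleIIB kpar)).IsClosedForm) (θ : ℝ)
    (Hf : DForm I M ℝ 3) (F1 : DForm I M ℝ 1) (F3 : DForm I M ℝ 3) :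
    SolvesIIB S kpar gs θ Hf F1 F3 ↔ Hf = 0 ∧ F1 = 0 ∧ F3 = 0 := by
  rw [DForm.IsClosedForm] at hre him hΩ hpar hperp
  have hc : (kPerp kpar * Complex.exp (θ * Complex.I) * gs : ℂ) ≠ 0 :=
    mul_ne_zero (mul_ne_zero (Complex.ofReal_ne_zero.2 hkp) (Complex.exp_ne_zero _))
      (Complex.ofReal_ne_zero.2 hgs)
  constructor
  · intro h
    have hH : Hf = 0 := by
      have := h.flux_H
      rw [hΩ, DForm.smul_zero] at this
      exact DForm.eq_zero_of_smul hk this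
    refine ⟨hH, ?_, ?_⟩
    · obtain ⟨G, hG, e⟩ := h.flux_F1
      rw [hH, DForm.zero_wedge, DForm.toComplex_zero, DForm.smul_toComplex_eq_zero_iff hc] at e
      rw [e] at hG
      exact eq_zero_of_isHodgeStar_zero hS hG
    · obtain ⟨G, hG, e⟩ := h.flux_F3
      rw [hpar, DForm.toComplex_zero, DForm.smul_toComplex_eq_zero_iff hc] at e
      rw [e] at hG
      exact eq_zero_of_isHodgeStar_zero hS hG
  · rintro ⟨rfl, rfl, rfl⟩
    refine ⟨hre, him, ?_, ?_, ?_, ?_, ⟨0, isHodgeStar_zero _, ?_⟩, ⟨0, isHodgeStar_zero _, ?_⟩⟩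
    · rw [hΩ, DForm.smul_zero, DForm.smul_zero]
    · rw [hperp, DForm.wedge_zero, DForm.wedge_zero, DForm.smul_zero]
    · rw [hperp, DForm.wedge_zero, DForm.wedge_zero, DForm.smul_zero]
    · rw [hpar, DForm.wedge_zero, DForm.zero_wedge, neg_zero]
    · rw [DForm.zero_wedge, DForm.toComplex_zero, ← DForm.toComplex_zero,
        (DForm.smul_toComplex_eq_zero_iff hc).2 rfl, DForm.toComplex_zero]
    · rw [hpar, (DForm.smul_toComplex_eq_zero_iff hc).2 rfl, DForm.toComplex_zero]

theorem exists_isUnitaryFrame_of_vectors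
    (S : SU2Structure I M) {x : M}
    (f : Fin 6 → TangentSpace I x)
    (h : ∀ i j, S.g.inner x (f i) (f j) = if i = j then 1 else 0)
    (hJ : ∀ i j, S.g.inner x (S.J x (f i)) (f j) = stdSymplectic i j) :
    ∃ e, S.IsUnitaryFrame x e := by
  have hli : LinearIndependent ℝ f := by
    rw [Fintype.linearIndependent_iff]
    intro c hc j
    have := congr_arg (fun v => S.g.inner x v (f j)) hc
    simpa [h, sum_apply] using this
  let e := basisOfLinearIndependentOfCardEqFinrank hli
    (by rw [show Module.finrank ℝ (TangentSpace I x) = 6 from S.dim_eq]; simp)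
  have he : (e : Fin 6 → TangentSpace I x) = f := coe_basisOfLinearIndependentOfCardEqFinrank _ _
  exact ⟨e, fun i j => by rw [he, h], fun i j => by rw [he, hJ]⟩

end SU2Structure

section ProductFrame

variable {E : Type*} [NormedAddCommGroup E] [NormedSpace ℝ E] [FiniteDimensional ℝ E]
  {H : Type*} [TopologicalSpace H] {I : ModelWithCorners ℝ E H}
  {N : Type*} [TopologicalSpace N] [ChartedSpace H N] [IsManifold I ∞ N]
  [RiemannianBundle (fun x : N => TangentSpace I x)]
  [IsContMDiffRiemannianBundle I ∞ E (fun x : N => TangentSpace I x)]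
  {E' : Type*} [NormedAddCommGroup E'] [NormedSpace ℝ E'] [FiniteDimensional ℝ E']
  {H' : Type*} [TopologicalSpace H'] {I' : ModelWithCorners ℝ E' H'}
  {T : Type*} [TopologicalSpace T] [ChartedSpace H' T] [IsManifold I' ∞ T]
  [I.Boundaryless] [I'.Boundaryless]

theorem exists_isUnitaryFrame_productSU2 (hE : Module.finrank ℝ E = 4)
    (hE' : Module.finrank ℝ E' = 2) (P Q R : OrthogonalComplexStructure I N)
    (hPQ : ∀ x v, P.toFun x (Q.toFun x v) = R.toFun x v)
    (hQP : ∀ x v, Q.toFun x (P.toFun x v) = -R.toFun x v)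
    {a b : DForm I' T ℝ 1} (ha : a.IsSmooth) (hb : b.IsSmooth) (D : DualFrame a b) (p : N × T) :
    ∃ e, (productSU2 hE hE' P Q R hPQ hQP ha hb D).IsUnitaryFrame p e := by
  obtain ⟨e, he, e1, -, e3⟩ := P.exists_adapted_basis hE Q (fun x v => by rw [hPQ, hQP, neg_neg])
    p.1
  have ho := orthonormal_iff_ite.1 he
  have f1 : P.toFun p.1 (e 1) = -e 0 := by rw [← e1, P.sq]
  have f3 : P.toFun p.1 (e 3) = -e 2 := by rw [← e3, P.sq]
  have h1 : ∀ u w, tangentFst I I' p (tangentPair I I' p u w) = u := fun _ _ => rfl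
  have h2 : ∀ u w, tangentSnd I I' p (tangentPair I I' p u w) = w := fun _ _ => rfl
  refine SU2Structure.exists_isUnitaryFrame_of_vectors _
    ![tangentPair I I' p (e 0) 0, tangentPair I I' p (e 1) 0, tangentPair I I' p (e 2) 0,
      tangentPair I I' p (e 3) 0, tangentPair I I' p 0 (D.A p.2), tangentPair I I' p 0 (D.B p.2)]
    (fun i j => ?_) (fun i j => ?_)
  · change productInner I I' a b p _ _ = _
    rw [productInner_apply]
    fin_cases i <;> fin_cases j <;>
      simp [h1, h2, ho, D.a_A, D.a_B, D.b_A, D.b_B, he.norm_eq_one]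
  · change productInner I I' a b p (productEndo P D p _) _ = _
    rw [inner_productEndo]
    fin_cases i <;> fin_cases j <;>
      simp [h1, h2, ho, D.a_A, D.a_B, D.b_A, D.b_B, he.norm_eq_one, e1, e3, f1, f3, stdSymplectic]

end ProductFrame

/-! ### Rotating a hyperkähler triple -/

namespace OrthogonalComplexStructure

variable {E : Type*} [NormedAddCommGroup E] [NormedSpace ℝ E]
  {H : Type*} [TopologicalSpace H] {I : ModelWithCorners ℝ E H}
  {N : Type*} [TopologicalSpace N] [ChartedSpace H N] [IsManifold I ∞ N]
  [RiemannianBundle (fun x : N => TangentSpace I x)]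

theorem combination_quaternion {X Y Z : OrthogonalComplexStructure I N}
    (hXY : ∀ x v, X.toFun x (Y.toFun x v) = Z.toFun x v)
    (hYX : ∀ x v, Y.toFun x (X.toFun x v) = -Z.toFun x v)
    (h : ∀ x v, X.toFun x (Y.toFun x v) = -Y.toFun x (X.toFun x v)) {c s : ℝ}
    (hcs : c ^ 2 + s ^ 2 = 1) (hsc : (-s) ^ 2 + c ^ 2 = 1) :
    (∀ x v, (X.combination Y h c s hcs).toFun x ((X.combination Y h (-s) c hsc).toFun x v) =
      Z.toFun x v) ∧
    ∀ x v, (X.combination Y h (-s) c hsc).toFun x ((X.combination Y h c s hcs).toFun x v) =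
      -Z.toFun x v := by
  have hZ : ∀ x v, Z.toFun x v = (c ^ 2 + s ^ 2) • Z.toFun x v := fun x v => by
    rw [hcs, one_smul]
  refine ⟨fun x v => ?_, fun x v => ?_⟩ <;>
  · simp only [combination_apply, map_add, map_smul, hXY, hYX, X.sq, Y.sq]
    conv_rhs => rw [hZ]
    module

theorem pullback_kahlerForm_combination_apply (X Y : OrthogonalComplexStructure I N)
    (h : ∀ x v, X.toFun x (Y.toFun x v) = -Y.toFun x (X.toFun x v)) (c s : ℝ)
    (hcs : c ^ 2 + s ^ 2 = 1) {E' : Type*} [NormedAddCommGroup E'] [NormedSpace ℝ E']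
    {H' : Type*} [TopologicalSpace H'] {I' : ModelWithCorners ℝ E' H'}
    {M : Type*} [TopologicalSpace M] [ChartedSpace H' M] (φ : M → N) (x : M)
    (v : Fin 2 → TangentSpace I' x) :
    ((X.combination Y h c s hcs).kahlerForm.pullback φ : DForm I' M ℝ 2) x v =
      c * (X.kahlerForm.pullback φ : DForm I' M ℝ 2) x v +
        s * (Y.kahlerForm.pullback φ : DForm I' M ℝ 2) x v := by
  rw [kahlerForm_combination]
  rfl

end OrthogonalComplexStructure

theorem SU2Structure.reOmegaPar_apply {E : Type*} [NormedAddCommGroup E] [NormedSpace ℝ E]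
    {H : Type*} [TopologicalSpace H] {I : ModelWithCorners ℝ E H}
    {M : Type*} [TopologicalSpace M] [ChartedSpace H M] [IsManifold I ∞ M]
    (S : SU2Structure I M) (φ : ℝ) (x : M) (v : Fin 2 → TangentSpace I x) :
    S.reOmegaPar φ x v =
      1 / 2 * ((1 - Real.cos (2 * φ)) * S.Omega.re x v + Real.sin (2 * φ) * S.omega x v) := rfl

theorem SU2Structure.reOmegaPerp_apply {E : Type*} [NormedAddCommGroup E] [NormedSpace ℝ E]
    {H : Type*} [TopologicalSpace H] {I : ModelWithCorners ℝ E H}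
    {M : Type*} [TopologicalSpace M] [ChartedSpace H M] [IsManifold I ∞ M]
    (S : SU2Structure I M) (φ : ℝ) (x : M) (v : Fin 2 → TangentSpace I x) :
    S.reOmegaPerp φ x v =
      1 / 2 * ((1 + Real.cos (2 * φ)) * S.Omega.re x v - Real.sin (2 * φ) * S.omega x v) := rfl

section Angles

variable {k : ℝ}

theorem kPerp_pos (hk : k ∈ Set.Ioo (0 : ℝ) 1) : 0 < kPerp k :=
  Real.sqrt_pos.2 (by nlinarith [hk.1, hk.2])

theorem kPerp_sq (hk : k ∈ Set.Ioo (0 : ℝ) 1) : kPerp k ^ 2 + k ^ 2 = 1 := by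
  rw [kPerp, Real.sq_sqrt (by nlinarith [hk.1, hk.2])]
  ring

theorem cos_two_angleIIA (hk : k ∈ Set.Ioo (0 : ℝ) 1) :
    Real.cos (2 * angleIIA k) = 1 - 2 * k ^ 2 := by
  rw [Real.cos_two_mul, angleIIA, Real.cos_neg, Real.cos_arcsin,
    Real.sq_sqrt (by nlinarith [hk.1, hk.2])]
  ring

theorem sin_two_angleIIA (hk : k ∈ Set.Ioo (0 : ℝ) 1) :
    Real.sin (2 * angleIIA k) = -(2 * k * kPerp k) := by
  rw [Real.sin_two_mul, angleIIA, Real.cos_neg, Real.sin_neg, Real.cos_arcsin,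
    Real.sin_arcsin (by linarith [hk.1]) hk.2.le, kPerp]
  ring

theorem cos_two_angleIIB (hk : k ∈ Set.Ioo (0 : ℝ) 1) :
    Real.cos (2 * angleIIB k) = 2 * k ^ 2 - 1 := by
  rw [Real.cos_two_mul, angleIIB, Real.cos_arccos (by linarith [hk.1]) hk.2.le]

theorem sin_two_angleIIB (hk : k ∈ Set.Ioo (0 : ℝ) 1) :
    Real.sin (2 * angleIIB k) = 2 * k * kPerp k := by
  rw [Real.sin_two_mul, angleIIB, Real.cos_arccos (by linarith [hk.1]) hk.2.le, Real.sin_arccos,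
    kPerp]
  ring

end Angles

namespace HyperkahlerStructure

variable {E : Type*} [NormedAddCommGroup E] [NormedSpace ℝ E] [FiniteDimensional ℝ E]
  {H : Type*} [TopologicalSpace H] {I : ModelWithCorners ℝ E H}
  {N : Type*} [TopologicalSpace N] [ChartedSpace H N] [IsManifold I ∞ N]
  [RiemannianBundle (fun x : N => TangentSpace I x)]
  [IsContMDiffRiemannianBundle I ∞ E (fun x : N => TangentSpace I x)]
  (hk : HyperkahlerStructure I N)

theorem JK (x : N) (v : TangentSpace I x) : hk.J₁.toFun x (hk.K₁.toFun x v) = hk.I₁.toFun x v := by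
  rw [← hk.IJ, hk.JI, ← hk.IJ, hk.J₁.sq, map_neg, neg_neg]

theorem KJ (x : N) (v : TangentSpace I x) : hk.K₁.toFun x (hk.J₁.toFun x v) = -hk.I₁.toFun x v := by
  rw [← hk.IJ, hk.J₁.sq, map_neg]

theorem KI (x : N) (v : TangentSpace I x) : hk.K₁.toFun x (hk.I₁.toFun x v) = hk.J₁.toFun x v := by
  rw [← hk.IJ, hk.JI, map_neg, ← hk.IJ, hk.I₁.sq, neg_neg]

theorem IK (x : N) (v : TangentSpace I x) : hk.I₁.toFun x (hk.K₁.toFun x v) = -hk.J₁.toFun x v := by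
  rw [← hk.IJ, hk.I₁.sq]

theorem isClosedForm [I.Boundaryless] :
    hk.I₁.kahlerForm.IsClosedForm ∧ hk.J₁.kahlerForm.IsClosedForm ∧
      hk.K₁.kahlerForm.IsClosedForm := by
  obtain ⟨nabla, htor, hmet, h1, h2, h3⟩ := hk.parallel
  exact ⟨hk.I₁.isClosedForm_kahlerForm nabla htor hmet h1,
    hk.J₁.isClosedForm_kahlerForm nabla htor hmet h2,
    hk.K₁.isClosedForm_kahlerForm nabla htor hmet h3⟩

end HyperkahlerStructure

theorem linearIndependent_pair_smul {V : Type*} [AddCommGroup V] [Module ℝ V] {u v : V} {c d : ℝ}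
    (hc : c ≠ 0) (hd : d ≠ 0) (h : LinearIndependent ℝ ![u, v]) :
    LinearIndependent ℝ ![c • u, d • v] := by
  rw [LinearIndependent.pair_iff] at h ⊢
  intro s t hst
  rw [smul_smul, smul_smul] at hst
  obtain ⟨h1, h2⟩ := h _ _ hst
  exact ⟨(mul_eq_zero.1 h1).resolve_right hc, (mul_eq_zero.1 h2).resolve_right hd⟩

section Vacua

variable {E : Type*} [NormedAddCommGroup E] [NormedSpace ℝ E] [FiniteDimensional ℝ E]
  {H : Type*} [TopologicalSpace H] {I : ModelWithCorners ℝ E H}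
  {N : Type*} [TopologicalSpace N] [ChartedSpace H N] [IsManifold I ∞ N]
  [RiemannianBundle (fun x : N => TangentSpace I x)]
  [IsContMDiffRiemannianBundle I ∞ E (fun x : N => TangentSpace I x)]
  {E' : Type*} [NormedAddCommGroup E'] [NormedSpace ℝ E'] [FiniteDimensional ℝ E']
  {H' : Type*} [TopologicalSpace H'] {I' : ModelWithCorners ℝ E' H'}
  {T : Type*} [TopologicalSpace T] [ChartedSpace H' T] [IsManifold I' ∞ T]
  [I.Boundaryless] [I'.Boundaryless]

theorem exists_su2Structure_IIA (hE : Module.finrank ℝ E = 4) (hE' : Module.finrank ℝ E' = 2)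
    (hk : HyperkahlerStructure I N) {a b : DForm I' T ℝ 1} (ha : a.IsSmooth) (hb : b.IsSmooth)
    (hac : a.IsClosedForm) (hbc : b.IsClosedForm) (hab : ∀ t, LinearIndependent ℝ ![a t, b t])
    {k : ℝ} (hk' : k ∈ Set.Ioo (0 : ℝ) 1) :
    ∃ S : SU2Structure (I.prod I') (N × T),
      S.alpha.re = a.pullback Prod.snd ∧ S.alpha.im = b.pullback Prod.snd ∧
      S.reOmegaPar (angleIIA k) = -k • hk.J₁.kahlerForm.pullback Prod.fst ∧
      S.reOmegaPerp (angleIIA k) = kPerp k • hk.K₁.kahlerForm.pullback Prod.fst ∧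
      S.Omega.im = hk.I₁.kahlerForm.pullback Prod.fst ∧
      ∀ gs : ℝ, 0 < gs → ∀ Hf F0 F2 F4,
        SolvesIIA S k gs Hf F0 F2 F4 ↔ Hf = 0 ∧ F0 = 0 ∧ F2 = 0 ∧ F4 = 0 := by
  obtain ⟨D⟩ := DualFrame.nonempty hE' hab
  have hcs := kPerp_sq hk'
  have hsc : (-k) ^ 2 + kPerp k ^ 2 = 1 := by rw [← hcs]; ring
  have hanti : ∀ x v, hk.J₁.toFun x (hk.K₁.toFun x v) = -hk.K₁.toFun x (hk.J₁.toFun x v) :=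
    fun x v => by rw [hk.JK, hk.KJ, neg_neg]
  obtain ⟨hPQ, hQP⟩ := OrthogonalComplexStructure.combination_quaternion hk.JK hk.KJ hanti hcs hsc
  obtain ⟨hI, hJ, hK⟩ := hk.isClosedForm
  let S := productSU2 hE hE' _ _ hk.I₁ hPQ hQP ha hb D
  have hre : S.alpha.re = a.pullback Prod.snd := DForm.re_complex _ _
  have him : S.alpha.im = b.pullback Prod.snd := DForm.im_complex _ _
  have hΩ : S.Omega.im = hk.I₁.kahlerForm.pullback Prod.fst := DForm.im_complex _ _
  have hΩr : ∀ p v, S.Omega.re p v = -k * hk.J₁.kahlerForm.pullback Prod.fst p v +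
      kPerp k * hk.K₁.kahlerForm.pullback Prod.fst p v := fun p v => by
    rw [show S.Omega.re = _ from DForm.re_complex _ _]
    exact OrthogonalComplexStructure.pullback_kahlerForm_combination_apply _ _ _ _ _ hsc _ p v
  have hω : ∀ p v, S.omega p v = kPerp k * hk.J₁.kahlerForm.pullback Prod.fst p v +
      k * hk.K₁.kahlerForm.pullback Prod.fst p v := fun p v =>
    OrthogonalComplexStructure.pullback_kahlerForm_combination_apply _ _ _ _ _ hcs _ p v
  have hpar : S.reOmegaPar (angleIIA k) = -k • hk.J₁.kahlerForm.pullback Prod.fst := by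
    funext p
    ext v
    rw [SU2Structure.reOmegaPar_apply, hΩr, hω, cos_two_angleIIA hk', sin_two_angleIIA hk',
      Pi.smul_apply, ContinuousAlternatingMap.smul_apply, smul_eq_mul]
    linear_combination (-k * hk.J₁.kahlerForm.pullback Prod.fst p v) * hcs
  have hperp : S.reOmegaPerp (angleIIA k) = kPerp k • hk.K₁.kahlerForm.pullback Prod.fst := by
    funext p
    ext v
    rw [SU2Structure.reOmegaPerp_apply, hΩr, hω, cos_two_angleIIA hk', sin_two_angleIIA hk',
      Pi.smul_apply, ContinuousAlternatingMap.smul_apply, smul_eq_mul]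
    linear_combination (k * hk.J₁.kahlerForm.pullback Prod.fst p v) * hcs
  have sJ := hk.J₁.isSmooth_kahlerForm.pullback (isLinearInCharts_fst (I := I) (I' := I') (M' := T))
  have cJ := hJ.pullback (isLinearInCharts_fst (I := I) (I' := I') (M' := T))
    hk.J₁.isSmooth_kahlerForm
  have sb := hb.pullback (isLinearInCharts_snd (I := I) (I' := I') (M := N))
  have cb := hbc.pullback (isLinearInCharts_snd (I := I) (I' := I') (M := N)) hb
  refine ⟨S, hre, him, hpar, hperp, hΩ, fun gs hgs => SU2Structure.solvesIIA_iff
    (exists_isUnitaryFrame_productSU2 hE hE' _ _ hk.I₁ hPQ hQP ha hb D) hk'.1.ne' hgs.ne'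
    ?_ ?_ ?_ ?_ ?_ ?_⟩
  · rw [hre]; exact hac.pullback isLinearInCharts_snd ha
  · rw [him]; exact cb
  · rw [hΩ]; exact hI.pullback isLinearInCharts_fst hk.I₁.isSmooth_kahlerForm
  · rw [hpar]; exact cJ.smul _
  · rw [hperp]; exact (hK.pullback isLinearInCharts_fst hk.K₁.isSmooth_kahlerForm).smul _
  · rw [hpar, him]; exact DForm.IsClosedForm.wedge_one_two sb (DForm.IsSmooth.smul sJ _) cb (cJ.smul _)

theorem exists_su2Structure_IIB (hE : Module.finrank ℝ E = 4) (hE' : Module.finrank ℝ E' = 2)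
    (hk : HyperkahlerStructure I N) {a b : DForm I' T ℝ 1} (ha : a.IsSmooth) (hb : b.IsSmooth)
    (hac : a.IsClosedForm) (hbc : b.IsClosedForm) (hab : ∀ t, LinearIndependent ℝ ![a t, b t])
    {k : ℝ} (hk' : k ∈ Set.Ioo (0 : ℝ) 1) :
    ∃ S : SU2Structure (I.prod I') (N × T),
      S.alpha.re = a.pullback Prod.snd ∧ S.alpha.im = b.pullback Prod.snd ∧
      S.reOmegaPar (angleIIB k) = kPerp k • hk.K₁.kahlerForm.pullback Prod.fst ∧
      S.reOmegaPerp (angleIIB k) = k • hk.I₁.kahlerForm.pullback Prod.fst ∧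
      S.Omega.im = hk.J₁.kahlerForm.pullback Prod.fst ∧
      ∀ gs : ℝ, 0 < gs → ∀ (θ : ℝ) Hf F1 F3,
        SolvesIIB S k gs θ Hf F1 F3 ↔ Hf = 0 ∧ F1 = 0 ∧ F3 = 0 := by
  obtain ⟨D⟩ := DualFrame.nonempty hE' hab
  have hsq := kPerp_sq hk'
  have hcs : k ^ 2 + (-kPerp k) ^ 2 = 1 := by rw [← hsq]; ring
  have hsc : (- -kPerp k) ^ 2 + k ^ 2 = 1 := by rw [← hsq]; ring
  have hanti : ∀ x v, hk.K₁.toFun x (hk.I₁.toFun x v) = -hk.I₁.toFun x (hk.K₁.toFun x v) :=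
    fun x v => by rw [hk.KI, hk.IK, neg_neg]
  obtain ⟨hPQ, hQP⟩ := OrthogonalComplexStructure.combination_quaternion hk.KI hk.IK hanti hcs hsc
  obtain ⟨hI, hJ, hK⟩ := hk.isClosedForm
  let S := productSU2 hE hE' _ _ hk.J₁ hPQ hQP ha hb D
  have hre : S.alpha.re = a.pullback Prod.snd := DForm.re_complex _ _
  have him : S.alpha.im = b.pullback Prod.snd := DForm.im_complex _ _
  have hΩ : S.Omega.im = hk.J₁.kahlerForm.pullback Prod.fst := DForm.im_complex _ _
  have hΩr : ∀ p v, S.Omega.re p v = - -kPerp k * hk.K₁.kahlerForm.pullback Prod.fst p v +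
      k * hk.I₁.kahlerForm.pullback Prod.fst p v := fun p v => by
    rw [show S.Omega.re = _ from DForm.re_complex _ _]
    exact OrthogonalComplexStructure.pullback_kahlerForm_combination_apply _ _ _ _ _ hsc _ p v
  have hω : ∀ p v, S.omega p v = k * hk.K₁.kahlerForm.pullback Prod.fst p v +
      -kPerp k * hk.I₁.kahlerForm.pullback Prod.fst p v := fun p v =>
    OrthogonalComplexStructure.pullback_kahlerForm_combination_apply _ _ _ _ _ hcs _ p v
  have hpar : S.reOmegaPar (angleIIB k) = kPerp k • hk.K₁.kahlerForm.pullback Prod.fst := by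
    funext p
    ext v
    rw [SU2Structure.reOmegaPar_apply, hΩr, hω, cos_two_angleIIB hk', sin_two_angleIIB hk',
      Pi.smul_apply, ContinuousAlternatingMap.smul_apply, smul_eq_mul]
    linear_combination (-k * hk.I₁.kahlerForm.pullback Prod.fst p v) * hsq
  have hperp : S.reOmegaPerp (angleIIB k) = k • hk.I₁.kahlerForm.pullback Prod.fst := by
    funext p
    ext v
    rw [SU2Structure.reOmegaPerp_apply, hΩr, hω, cos_two_angleIIB hk', sin_two_angleIIB hk',
      Pi.smul_apply, ContinuousAlternatingMap.smul_apply, smul_eq_mul]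
    linear_combination (k * hk.I₁.kahlerForm.pullback Prod.fst p v) * hsq
  refine ⟨S, hre, him, hpar, hperp, hΩ, fun gs hgs => SU2Structure.solvesIIB_iff
    (exists_isUnitaryFrame_productSU2 hE hE' _ _ hk.J₁ hPQ hQP ha hb D) hk'.1.ne'
    (kPerp_pos hk').ne' hgs.ne' ?_ ?_ ?_ ?_ ?_⟩
  · rw [hre]; exact hac.pullback isLinearInCharts_snd ha
  · rw [him]; exact hbc.pullback isLinearInCharts_snd hb
  · rw [hΩ]; exact hJ.pullback isLinearInCharts_fst hk.J₁.isSmooth_kahlerForm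
  · rw [hpar]; exact (hK.pullback isLinearInCharts_fst hk.K₁.isSmooth_kahlerForm).smul _
  · rw [hperp]; exact (hI.pullback isLinearInCharts_fst hk.I₁.isSmooth_kahlerForm).smul _

end Vacua

end FluxVacua

end

open FluxVacua

theorem proposition3p7
    {N : Type*} [TopologicalSpace N] [T2Space N] [CompactSpace N]
    [ChartedSpace (EuclideanSpace ℝ (Fin 4)) N] [IsManifold (𝓡 4) ∞ N]
    [RiemannianBundle (fun x : N => TangentSpace (𝓡 4) x)]
    [IsContMDiffRiemannianBundle (𝓡 4) ∞ (EuclideanSpace ℝ (Fin 4))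
      (fun x : N => TangentSpace (𝓡 4) x)]
    (hk : HyperkahlerStructure (𝓡 4) N)
    (β₁ β₂ : DForm ((𝓡 1).prod (𝓡 1)) Torus ℝ 1)
    (hβ₁ : β₁.IsSmooth) (hβ₂ : β₂.IsSmooth)
    (hβ₁_closed : β₁.IsClosedForm) (hβ₂_closed : β₂.IsClosedForm)
    (hβ_basis : ∀ t : Torus, LinearIndependent ℝ ![β₁ t, β₂ t])
    (kpar : ℝ) (hkpar : kpar ∈ Set.Ioo (0 : ℝ) 1) :
    (∃ S : SU2Structure ((𝓡 4).prod ((𝓡 1).prod (𝓡 1))) (N × Torus),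
      S.alpha.re = β₁.pullback Prod.snd ∧
      S.alpha.im = (1 / kpar) • β₂.pullback Prod.snd ∧
      S.reOmegaPar (angleIIA kpar) = -kpar • hk.J₁.kahlerForm.pullback Prod.fst ∧
      S.reOmegaPerp (angleIIA kpar) = kPerp kpar • hk.K₁.kahlerForm.pullback Prod.fst ∧
      S.Omega.im = hk.I₁.kahlerForm.pullback Prod.fst ∧
      ∀ gs : ℝ, 0 < gs → ∀ Hf F0 F2 F4,
        SolvesIIA S kpar gs Hf F0 F2 F4 ↔ Hf = 0 ∧ F0 = 0 ∧ F2 = 0 ∧ F4 = 0) ∧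
    (∃ S : SU2Structure ((𝓡 4).prod ((𝓡 1).prod (𝓡 1))) (N × Torus),
      S.alpha.re = (1 / kpar) • β₁.pullback Prod.snd ∧
      S.alpha.im = β₂.pullback Prod.snd ∧
      S.reOmegaPar (angleIIB kpar) = kPerp kpar • hk.K₁.kahlerForm.pullback Prod.fst ∧
      S.reOmegaPerp (angleIIB kpar) = kpar • hk.I₁.kahlerForm.pullback Prod.fst ∧
      S.Omega.im = hk.J₁.kahlerForm.pullback Prod.fst ∧
      ∀ gs : ℝ, 0 < gs → ∀ (θ : ℝ) Hf F1 F3,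
        SolvesIIB S kpar gs θ Hf F1 F3 ↔ Hf = 0 ∧ F1 = 0 ∧ F3 = 0) := by
  have hE : Module.finrank ℝ (EuclideanSpace ℝ (Fin 4)) = 4 := by simp
  have hE' : Module.finrank ℝ (EuclideanSpace ℝ (Fin 1) × EuclideanSpace ℝ (Fin 1)) = 2 := by
    simp
  have hk0 : 1 / kpar ≠ 0 := one_div_ne_zero hkpar.1.ne'
  refine ⟨?_, ?_⟩
  · refine exists_su2Structure_IIA hE hE' hk hβ₁ (hβ₂.smul (1 / kpar)) hβ₁_closed
      (hβ₂_closed.smul (1 / kpar)) (fun t => ?_) hkpar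
    simpa using linearIndependent_pair_smul one_ne_zero hk0 (hβ_basis t)
  · refine exists_su2Structure_IIB hE hE' hk (hβ₁.smul (1 / kpar)) hβ₂
      (hβ₁_closed.smul (1 / kpar)) hβ₂_closed (fun t => ?_) hkpar
    simpa using linearIndependent_pair_smul hk0 one_ne_zero (hβ_basis t)
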